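/- Let $A$ be a separable unital C$^*$-algebra. Let $\mathrm{T}(A)$ be the (possibly empty) set of tracial states on $A$, let $\mathrm{tr}_k$ be the normalized trace on the $k\times k$ complex matrices $M_k(\mathbb C)$, and let $\|x\|_2=\mathrm{tr}_k(x^*x)^{1/2}$ for $x\in M_k(\mathbb C)$. For a trace $\tau\in \mathrm{T}(A)$ consider sequences of unital completely positive maps $\phi_n:A\to M_{k(n)}(\mathbb C)$, and define: - $\tau\in \mathrm{T}(A)_{\mathrm{AFD}}$ if there is such a sequence with $\|\phi_n(ab)-\phi_n(a)\phi_n(b)\|\to 0$ for all $a,b\in A$ and $\mathrm{tr}_{k(n)}(\phi_n(a))\to\tau(a)$ for all $a\in A$; - $\tau\in \mathrm{T}(A)_{\mathrm{w\text{-}AFD}}$ if there is such a sequence with $\|\phi_n(ab)-\phi_n(a)\phi_n(b)\|_2\to 0$ for all $a,b\in A$ and $\mathrm{tr}_{k(n)}(\phi_n(a))\to\tau(a)$ for all $a\in A$; - $\tau\in \mathrm{UT}(A)_{\mathrm{AFD}}$ (respectively $\tau\in \mathrm{UT}(A)_{\mathrm{w\text{-}AFD}}$) if there is a sequence as in the first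 (respectively second) item for which, moreover, $\|\tau-\mathrm{tr}_{k(n)}\circ\phi_n\|_{A^*}\to 0$. Let $A^{**}$ be the enveloping von Neumann algebra of $A$. Call $A$ locally reflexive if for every finite-dimensional operator system $X\subset A^{**}$ there is a net of contractive completely positive maps $\alpha_i:X\to A$ such that $\alpha_i(x)\to x$ in the weak-$*$ topology of $A^{**}=(A^*)^*$ for every $x\in X$. **Theorem.** If $A$ is locally reflexive, then $$\mathrm{T}(A)_{\mathrm{w\text{-}AFD}}=\mathrm{UT}(A)_{\mathrm{w\text{-}AFD}}\qquad\text{and}\qquad \mathrm{T}(A)_{\mathrm{AFD}}=\mathrm{UT}(A)_{\mathrm{AFD}}.$$ -/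

import Mathlib

universe u

open Filter Topology
open scoped ComplexOrder CStarAlgebra InnerProductSpace ENNReal

noncomputable section

namespace AFDTraces

/-! ### The universal representation and the enveloping von Neumann algebra -/

section Enveloping

variable (A : Type u) [CStarAlgebra A] [PartialOrder A] [StarOrderedRing A]

/-- The state space of a unital C⋆-algebra. -/
def State : Type u := {f : A →ₚ[ℂ] ℂ // f 1 = 1}

/-- The Hilbert space of the universal representation: the `ℓ²`-direct sum of the GNS spaces
of all states. -/
abbrev UniversalSpace : Type u := lp (fun f : State A => f.1.GNS) 2

variable {A}

theorem universalRep_bound (a : A) (f : State A) : ‖f.1.gnsStarAlgHom a‖ ≤ ‖a‖ :=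
  NonUnitalStarAlgHom.norm_apply_le f.1.gnsStarAlgHom a

/-- The operator by which `a` acts on the direct sum of all the GNS spaces. -/
def universalOp (a : A) : UniversalSpace A →L[ℂ] UniversalSpace A :=
  lp.mapCLM 2 (fun f : State A => f.1.gnsStarAlgHom a) (norm_nonneg a) (universalRep_bound a)

theorem universalOp_apply (a : A) (ξ : UniversalSpace A) (f : State A) :
    universalOp a ξ f = f.1.gnsStarAlgHom a (ξ f) := rfl

variable (A) in
/-- The universal representation of `A`: the direct sum of the GNS representations of all
states of `A`. -/
def universalRep : A →⋆ₐ[ℂ] (UniversalSpace A →L[ℂ] UniversalSpace A) where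
  toFun := universalOp
  map_one' := by
    ext ξ f
    simp only [universalOp_apply, map_one, one_apply_eq_self]
  map_mul' a b := by
    ext ξ f
    simp only [universalOp_apply, map_mul, mul_apply_eq_comp]
  map_zero' := by
    ext ξ f
    simp only [universalOp_apply, map_zero]
    rfl
  map_add' a b := by
    ext ξ f
    simp only [universalOp_apply, map_add]
    rfl
  commutes' r := by
    ext ξ f
    simp only [universalOp_apply, Algebra.algebraMap_eq_smul_one, map_smul, map_one]
    rfl
  map_star' a := by
    rw [ContinuousLinearMap.star_eq_adjoint, ContinuousLinearMap.eq_adjoint_iff]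
    intro ξ η
    rw [lp.inner_eq_tsum, lp.inner_eq_tsum]
    refine tsum_congr fun f => ?_
    rw [universalOp_apply, universalOp_apply, map_star, ContinuousLinearMap.star_eq_adjoint,
      ContinuousLinearMap.adjoint_inner_left]

variable (A) in
/-- The enveloping von Neumann algebra `A**` of `A`, realized as the double commutant of the
image of `A` under the universal representation. -/
def enveloping : VonNeumannAlgebra (UniversalSpace A) where
  toStarSubalgebra :=
    StarSubalgebra.centralizer ℂ
      (StarSubalgebra.centralizer ℂ (Set.range (universalRep A)) :
        Set (UniversalSpace A →L[ℂ] UniversalSpace A))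
  centralizer_centralizer' := by
    simp

theorem star_range_universalRep :
    star (Set.range (universalRep A)) = Set.range (universalRep A) := by
  ext x
  rw [Set.mem_star]
  constructor
  · rintro ⟨a, ha⟩
    exact ⟨star a, by rw [map_star, ha, star_star]⟩
  · rintro ⟨a, rfl⟩
    exact ⟨star a, map_star _ _⟩

variable (A) in
/-- The underlying set of `enveloping A` is `π(A)''`, for `π` the universal representation. -/
theorem coe_enveloping :
    (enveloping A : Set (UniversalSpace A →L[ℂ] UniversalSpace A)) =
      Set.centralizer (Set.centralizer (Set.range (universalRep A))) := by
  have h : ((StarSubalgebra.centralizer ℂ (Set.range (universalRep A)) :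
      StarSubalgebra ℂ (UniversalSpace A →L[ℂ] UniversalSpace A)) :
        Set (UniversalSpace A →L[ℂ] UniversalSpace A)) =
      Set.centralizer (Set.range (universalRep A)) := by
    rw [StarSubalgebra.coe_centralizer, star_range_universalRep, Set.union_self]
  rw [← VonNeumannAlgebra.coe_toStarSubalgebra, enveloping]
  rw [StarSubalgebra.coe_centralizer, StarMemClass.star_coe_eq, Set.union_self, h]

end Enveloping

/-! ### Local reflexivity -/

section LocallyReflexive

variable (A : Type u) [CStarAlgebra A] [PartialOrder A] [StarOrderedRing A]

/-- `X` is a finite-dimensional operator system in `A**`. -/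
structure IsFinDimOperatorSystem
    (X : Submodule ℂ (UniversalSpace A →L[ℂ] UniversalSpace A)) : Prop where
  subset_enveloping : ∀ x ∈ X, x ∈ enveloping A
  one_mem : (1 : UniversalSpace A →L[ℂ] UniversalSpace A) ∈ X
  star_mem : ∀ x ∈ X, star x ∈ X
  finiteDimensional : FiniteDimensional ℂ X

variable {A}

/-- `α : X → A` is a contractive completely positive map, where `X` carries the matrix order
inherited from the bounded operators on the universal Hilbert space. -/
structure IsContractiveCP {X : Submodule ℂ (UniversalSpace A →L[ℂ] UniversalSpace A)}
    (α : X →ₗ[ℂ] A) : Prop where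
  map_cstarMatrix_nonneg : ∀ (k : ℕ) (M : Matrix (Fin k) (Fin k) X),
    0 ≤ CStarMatrix.ofMatrix
        (M.map (Subtype.val : X → (UniversalSpace A →L[ℂ] UniversalSpace A))) →
      0 ≤ CStarMatrix.ofMatrix (M.map α)
  contractive : ∀ x : X, ‖α x‖ ≤ ‖x‖

variable (A) in
/-- `A` is locally reflexive: for every finite-dimensional operator system `X ⊆ A**` there is a
net of contractive completely positive maps `α i : X → A` with `α i x → x` in the weak-⋆ topology
of `A**` for every `x ∈ X`.

Every state of `A` is a vector functional of the universal representation and every bounded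
functional on `A` is a linear combination of states, so on `A**` the weak-⋆ topology coming from
`A*` is the weak operator topology of the universal Hilbert space. -/
def IsLocallyReflexive : Prop :=
  ∀ X : Submodule ℂ (UniversalSpace A →L[ℂ] UniversalSpace A), IsFinDimOperatorSystem A X →
    ∃ (ι : Type u) (_ : Preorder ι) (_ : IsDirectedOrder ι) (_ : Nonempty ι)
      (α : ι → X →ₗ[ℂ] A), (∀ i, IsContractiveCP (α i)) ∧
        ∀ (x : X) (ξ η : UniversalSpace A),
          Tendsto (fun i => ⟪ξ, universalRep A (α i x) η⟫_ℂ) atTop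
            (𝓝 ⟪ξ, (x : UniversalSpace A →L[ℂ] UniversalSpace A) η⟫_ℂ)

end LocallyReflexive

/-! ### Approximately finite dimensional traces -/

section Traces

/-- The C⋆-algebra of complex `k × k` matrices, with the operator norm. -/
abbrev Mat (k : ℕ) : Type := CStarMatrix (Fin k) (Fin k) ℂ

/-- The normalized trace `tr_k` on the complex `k × k` matrices. -/
def tr (k : ℕ) : Mat k →ₗ[ℂ] ℂ where
  toFun x := (k : ℂ)⁻¹ * ∑ i, x i i
  map_add' x y := by
    simp only [CStarMatrix.add_apply, Finset.sum_add_distrib, mul_add]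
  map_smul' c x := by
    simp only [CStarMatrix.smul_apply, smul_eq_mul, ← Finset.mul_sum, RingHom.id_apply]
    ring

/-- The 2-norm `‖x‖₂ = tr_k(x⋆ x)^{1/2}`. -/
def twoNorm {k : ℕ} (x : Mat k) : ℝ := √(tr k (star x * x)).re

variable (A : Type u) [CStarAlgebra A] [PartialOrder A] [StarOrderedRing A]

/-- The set `T(A)` of tracial states, inside the Banach space dual `A*`. -/
def TracialStates : Set (StrongDual ℂ A) :=
  {τ | (∀ a : A, 0 ≤ a → 0 ≤ τ a) ∧ τ 1 = 1 ∧ ∀ a b : A, τ (a * b) = τ (b * a)}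

variable {A}

/-- The functional `tr_k ∘ φ` as an element of `A*`. -/
def trComp {k : ℕ} (φ : A →CP Mat k) : StrongDual ℂ A where
  toLinearMap := tr k ∘ₗ φ.toLinearMap
  cont := by
    have h : Continuous (tr k) :=
      haveI : FiniteDimensional ℂ (Mat k) :=
        inferInstanceAs (FiniteDimensional ℂ (Matrix (Fin k) (Fin k) ℂ))
      LinearMap.continuous_of_finiteDimensional (tr k)
    exact h.comp (map_continuous φ)

variable (A) in
/-- A sequence of unital completely positive maps from `A` to matrix algebras. -/
structure UCPSeq where
  size : ℕ → ℕ
  size_pos : ∀ n, 0 < size n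
  map : ∀ n, A →CP Mat (size n)
  map_one : ∀ n, map n 1 = 1

namespace UCPSeq

/-- Asymptotic multiplicativity in operator norm. -/
def AsympMul (φ : UCPSeq A) : Prop :=
  ∀ a b : A, Tendsto (fun n => ‖φ.map n (a * b) - φ.map n a * φ.map n b‖) atTop (𝓝 0)

/-- Asymptotic multiplicativity in 2-norm. -/
def AsympMulTwo (φ : UCPSeq A) : Prop :=
  ∀ a b : A, Tendsto (fun n => twoNorm (φ.map n (a * b) - φ.map n a * φ.map n b)) atTop (𝓝 0)

/-- `tr ∘ φ_n → τ` in the weak-⋆ topology. -/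
def TendstoWeakStar (φ : UCPSeq A) (τ : StrongDual ℂ A) : Prop :=
  ∀ a : A, Tendsto (fun n => trComp (φ.map n) a) atTop (𝓝 (τ a))

/-- `tr ∘ φ_n → τ` in the norm of `A*`. -/
def TendstoNorm (φ : UCPSeq A) (τ : StrongDual ℂ A) : Prop :=
  Tendsto (fun n => ‖τ - trComp (φ.map n)‖) atTop (𝓝 0)

end UCPSeq

variable (A)

/-- `T(A)_{AFD}`: approximately finite dimensional traces. -/
def T_AFD : Set (StrongDual ℂ A) :=
  {τ | τ ∈ TracialStates A ∧ ∃ φ : UCPSeq A, φ.AsympMul ∧ φ.TendstoWeakStar τ}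

/-- `T(A)_{w-AFD}`: weakly approximately finite dimensional traces. -/
def T_wAFD : Set (StrongDual ℂ A) :=
  {τ | τ ∈ TracialStates A ∧ ∃ φ : UCPSeq A, φ.AsympMulTwo ∧ φ.TendstoWeakStar τ}

/-- `UT(A)_{AFD}`: uniformly approximately finite dimensional traces. -/
def UT_AFD : Set (StrongDual ℂ A) :=
  {τ | τ ∈ TracialStates A ∧ ∃ φ : UCPSeq A, φ.AsympMul ∧ φ.TendstoNorm τ}

/-- `UT(A)_{w-AFD}`: uniformly weakly approximately finite dimensional traces. -/
def UT_wAFD : Set (StrongDual ℂ A) :=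
  {τ | τ ∈ TracialStates A ∧ ∃ φ : UCPSeq A, φ.AsympMulTwo ∧ φ.TendstoNorm τ}

end Traces

end AFDTraces

end

/-! Norm convergence of functionals implies weak-⋆ convergence, so only the passage from weak-⋆ to
norm needs work. Fix finitely many elements c of A and ε > 0. The functionals tr ∘ ψ, with ψ unital
completely positive and ε-multiplicative on c, form a set with convex norm closure, because block
sums with multiplicities realize rational convex combinations (`almostMulTraces_natWeights`). By
Hahn–Banach it is therefore enough to match τ against one element y of A** at a time
(`mem_closure_almostMulTraces`). A diagonal argument over a dense sequence of A then produces the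
required sequence of maps.

Given y, local reflexivity supplies contractive completely positive maps α into A on an operator
system X containing y, 1, the c's and their products. A convexity argument turns weak convergence
into norm approximation on the elements of A (`exists_contractiveCP_approx`). For the given sequence
φ_n and n large, φ_n ∘ α is almost unital and almost multiplicative, and tr φ_n(α(y)) ≈ τ(α(y)) ≈
y(τ). This map lives only on X, but at finitely many points of X it is a limit of normal extensions
of completely positive maps ψ : A → M_k (`exists_cp_approx`); hence y(tr ∘ ψ) ≈ y(τ)
(`exists_almost_unital`). A small summand τ(·)b makes ψ unital (`exists_unital_near`).

Only the properties collected in `IsMatrixNorm` are used, so one argument serves both the operator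
norm and the 2-norm. -/

noncomputable section

namespace AFDTraces

/-! ### Positivity of matrices over a C⋆-algebra -/

section NegPart

variable {R : Type*} [NonUnitalCStarAlgebra R] [PartialOrder R] [StarOrderedRing R]

theorem exists_eq_star_mul_self_of_nonneg {a : R} (ha : 0 ≤ a) : ∃ c, a = star c * c :=
  CStarAlgebra.nonneg_iff_eq_star_mul_self.mp ha

/-- The witness is the negative part of a. It is used to detect positivity: conjugating by it
isolates exactly the obstruction. -/
theorem exists_nonneg_conj_eq_neg {a : R} (ha : IsSelfAdjoint a) :
    ∃ b : R, 0 ≤ b ∧ b * a * b = -(b * b * b) ∧ (b * b * b = 0 → 0 ≤ a) := by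
  have h2 : a⁺ - a⁻ = a := CFC.posPart_sub_negPart a ha
  have h3 : a⁺ * a⁻ = 0 := CFC.posPart_mul_negPart a
  have hN0 : 0 ≤ a⁻ := CFC.negPart_nonneg a
  have hNs : star a⁻ = a⁻ := (IsSelfAdjoint.of_nonneg hN0).star_eq
  refine ⟨a⁻, hN0, ?_, fun h5 => ?_⟩
  · have h4 : a * a⁻ = -(a⁻ * a⁻) := by
      nth_rewrite 1 [← h2]
      rw [sub_mul, h3, zero_sub]
    rw [mul_assoc, h4, mul_neg, mul_assoc]
  · have h8 : a⁻ * a⁻ = 0 := by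
      rw [← CStarRing.star_mul_self_eq_zero_iff, star_mul, hNs, ← mul_assoc, h5, zero_mul]
    have h9 : a⁻ = 0 := by
      rw [← CStarRing.star_mul_self_eq_zero_iff, hNs, h8]
    rw [← h2, h9, sub_zero]
    exact CFC.posPart_nonneg a

end NegPart

section MatrixPositivity

variable {B : Type*} [CStarAlgebra B] [PartialOrder B] [StarOrderedRing B]
variable {n : Type*} [Fintype n]

/-- With M = C⋆C the sum is ∑ᵣ (Cv)ᵣ⋆(Cv)ᵣ. -/
theorem CStarMatrix.sum_star_mul_mul_nonneg {M : CStarMatrix n n B} (hM : 0 ≤ M) (v : n → B) :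
    0 ≤ ∑ i, ∑ j, star (v i) * M i j * v j := by
  obtain ⟨C, rfl⟩ := exists_eq_star_mul_self_of_nonneg hM
  have h : ∑ i, ∑ j, star (v i) * (star C * C) i j * v j =
      ∑ r, star (∑ i, C r i * v i) * (∑ j, C r j * v j) := by
    simp only [CStarMatrix.mul_apply, CStarMatrix.star_apply, star_sum, star_mul,
      Finset.sum_mul, Finset.mul_sum]
    rw [Finset.sum_congr rfl fun i _ => Finset.sum_comm, Finset.sum_comm]
    refine Finset.sum_congr rfl fun r _ => ?_
    rw [Finset.sum_comm]
    simp only [mul_assoc]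
  rw [h]
  exact Finset.sum_nonneg fun r _ => star_mul_self_nonneg _

theorem CStarMatrix.eq_zero_of_diag_eq_zero {M : CStarMatrix n n B} (hM : 0 ≤ M)
    (h : ∀ i, M i i = 0) : M = 0 := by
  obtain ⟨C, rfl⟩ := exists_eq_star_mul_self_of_nonneg hM
  have hC : C = 0 := by
    ext r i
    have hi := h i
    simp only [CStarMatrix.mul_apply, CStarMatrix.star_apply] at hi
    rw [Finset.sum_eq_zero_iff_of_nonneg fun _ _ => star_mul_self_nonneg _] at hi
    exact (CStarRing.star_mul_self_eq_zero_iff _).mp (hi r (Finset.mem_univ r))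
  rw [hC, mul_zero]

theorem CStarMatrix.diag_nonneg {M : CStarMatrix n n B} (hM : 0 ≤ M) (p : n) : 0 ≤ M p p := by
  classical
  have h := CStarMatrix.sum_star_mul_mul_nonneg hM (Pi.single p 1)
  rw [Finset.sum_eq_single p (by intro i _ hi; simp [hi]) (by simp),
    Finset.sum_eq_single p (by intro i _ hi; simp [hi]) (by simp)] at h
  simpa using h

/-- Let N be the negative part of M. Testing on the columns of N shows that NMN = -N³ has
nonnegative diagonal. As N³ ≥ 0, its diagonal vanishes, so N³ = 0 and M ≥ 0. -/
theorem CStarMatrix.nonneg_of_sum_star_mul_mul_nonneg {M : CStarMatrix n n B}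
    (hs : IsSelfAdjoint M) (h : ∀ v : n → B, 0 ≤ ∑ i, ∑ j, star (v i) * M i j * v j) :
    0 ≤ M := by
  obtain ⟨N, hN0, h1, h2⟩ := exists_nonneg_conj_eq_neg hs
  have hNs : star N = N := (IsSelfAdjoint.of_nonneg hN0).star_eq
  have h3 : 0 ≤ N * N * N := by
    have := star_left_conjugate_nonneg hN0 N
    rwa [hNs] at this
  refine h2 (CStarMatrix.eq_zero_of_diag_eq_zero h3 fun p => ?_)
  refine le_antisymm ?_ (CStarMatrix.diag_nonneg h3 p)
  have h6 : (N * M * N) p p = ∑ i, ∑ j, star (N i p) * M i j * N j p := by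
    rw [mul_assoc]
    simp only [CStarMatrix.mul_apply, Finset.mul_sum]
    refine Finset.sum_congr rfl fun i _ => Finset.sum_congr rfl fun j _ => ?_
    rw [← CStarMatrix.star_apply, hNs, mul_assoc]
  have h7 := h fun i => N i p
  rw [← h6, h1, CStarMatrix.neg_apply] at h7
  exact neg_nonneg.mp h7

end MatrixPositivity

theorem CStarMatrix.isSelfAdjoint_map {B C F n : Type*} [Star B] [Star C] [FunLike F B C]
    (f : F) (hf : ∀ b, f (star b) = star (f b)) {M : CStarMatrix n n B} (hM : IsSelfAdjoint M) :
    IsSelfAdjoint (M.map f) := by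
  ext i j
  rw [CStarMatrix.star_apply, CStarMatrix.map_apply, CStarMatrix.map_apply, ← hf,
    CStarMatrix.star_apply_of_isSelfAdjoint hM]

theorem complex_smul_nonneg {R : Type*} [NonUnitalCStarAlgebra R] [PartialOrder R]
    [StarOrderedRing R] {a : R} (ha : 0 ≤ a) {c : ℝ} (hc : 0 ≤ c) : 0 ≤ (c : ℂ) • a := by
  rw [Complex.coe_smul]
  exact smul_nonneg hc ha

/-! ### Norm bounds for positive maps -/

section Positive

variable {R S : Type*} [CStarAlgebra R] [PartialOrder R] [StarOrderedRing R]
  [CStarAlgebra S] [PartialOrder S] [StarOrderedRing S]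

theorem norm_le_of_neg_le_of_le {x : S} {r : ℝ} (hr : 0 ≤ r) (h₁ : x ≤ algebraMap ℝ S r)
    (h₂ : -algebraMap ℝ S r ≤ x) : ‖x‖ ≤ r := by
  rcases subsingleton_or_nontrivial S with hS | hS
  · rwa [Subsingleton.elim x 0, norm_zero]
  have hx : IsSelfAdjoint x := by
    have h := IsSelfAdjoint.of_nonneg (sub_nonneg.mpr h₂)
    have h' := h.add (IsSelfAdjoint.algebraMap S (IsSelfAdjoint.all r)).neg
    simpa using h'
  rcases CStarAlgebra.norm_or_neg_norm_mem_spectrum hx with h | h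
  · exact (le_algebraMap_iff_spectrum_le hx).mp h₁ _ h
  · rw [← map_neg] at h₂
    have := (algebraMap_le_iff_le_spectrum hx).mp h₂ _ h
    linarith

/-- For self-adjoint b, apply f to -‖b‖ ≤ b ≤ ‖b‖. The factor 2 comes from splitting a into real and
imaginary parts; it is crude but sufficient. -/
theorem norm_le_of_map_nonneg (f : R →ₗ[ℂ] S) (hf : ∀ a, 0 ≤ a → 0 ≤ f a) (a : R) :
    ‖f a‖ ≤ 2 * ‖f 1‖ * ‖a‖ := by
  have h1 : 0 ≤ f 1 := hf 1 zero_le_one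
  have key (b : R) (hb : IsSelfAdjoint b) : ‖f b‖ ≤ ‖f 1‖ * ‖b‖ := by
    have hfr : f (algebraMap ℝ R ‖b‖) ≤ algebraMap ℝ S (‖f 1‖ * ‖b‖) := by
      have e : f (algebraMap ℝ R ‖b‖) = ‖b‖ • f 1 := by
        rw [Algebra.algebraMap_eq_smul_one, ← Complex.coe_smul, map_smul, Complex.coe_smul]
      rw [e, mul_comm, map_mul, ← Algebra.smul_def]
      exact smul_le_smul_of_nonneg_left (IsSelfAdjoint.of_nonneg h1).le_algebraMap_norm_self
        (norm_nonneg b)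
    refine norm_le_of_neg_le_of_le (by positivity) ?_ ?_
    · have := hf _ (sub_nonneg.mpr hb.le_algebraMap_norm_self)
      rw [map_sub, sub_nonneg] at this
      exact this.trans hfr
    · have := hf _ (sub_nonneg.mpr hb.neg_algebraMap_norm_le_self)
      rw [map_sub, map_neg, sub_nonneg] at this
      exact (neg_le_neg hfr).trans this
  have hdec := realPart_add_I_smul_imaginaryPart a
  calc ‖f a‖ = ‖f (realPart a : R) + Complex.I • f (imaginaryPart a : R)‖ := by
        rw [← map_smul, ← map_add, hdec]
    _ ≤ ‖f (realPart a : R)‖ + ‖Complex.I • f (imaginaryPart a : R)‖ := norm_add_le _ _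
    _ ≤ ‖f 1‖ * ‖(realPart a : R)‖ + ‖f 1‖ * ‖(imaginaryPart a : R)‖ := by
        rw [norm_smul, Complex.norm_I, one_mul]
        exact add_le_add (key _ (realPart a).2) (key _ (imaginaryPart a).2)
    _ ≤ ‖f 1‖ * ‖a‖ + ‖f 1‖ * ‖a‖ := by
        have h1 := realPart.norm_le a
        have h2 := imaginaryPart.norm_le a
        have h1' : ‖(realPart a : R)‖ ≤ ‖a‖ := h1
        have h2' : ‖(imaginaryPart a : R)‖ ≤ ‖a‖ := h2
        gcongr
    _ = 2 * ‖f 1‖ * ‖a‖ := by ring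

end Positive

/-! ### Completely positive maps and vector maps into matrix algebras -/

section CP

variable {A : Type u} [CStarAlgebra A] [PartialOrder A] [StarOrderedRing A]
variable {B C : Type*} [CStarAlgebra B] [PartialOrder B] [StarOrderedRing B]
  [CStarAlgebra C] [PartialOrder C] [StarOrderedRing C]

/-- The sum of two completely positive maps. -/
def cpAdd (φ ψ : A →CP B) : A →CP B where
  toLinearMap := φ.toLinearMap + ψ.toLinearMap
  map_cstarMatrix_nonneg' k M hM :=
    add_nonneg (φ.map_cstarMatrix_nonneg' k M hM) (ψ.map_cstarMatrix_nonneg' k M hM)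

theorem cpAdd_apply (φ ψ : A →CP B) (a : A) : cpAdd φ ψ a = φ a + ψ a := rfl

/-- A nonnegative multiple of a completely positive map. -/
def cpSMul (c : ℝ) (hc : 0 ≤ c) (φ : A →CP B) : A →CP B where
  toLinearMap := (c : ℂ) • φ.toLinearMap
  map_cstarMatrix_nonneg' k M hM :=
    complex_smul_nonneg (φ.map_cstarMatrix_nonneg' k M hM) hc

theorem cpSMul_apply (c : ℝ) (hc : 0 ≤ c) (φ : A →CP B) (a : A) :
    cpSMul c hc φ a = (c : ℂ) • φ a := rfl

/-- The zero map is completely positive. -/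
def cpZero : A →CP B where
  toLinearMap := 0
  map_cstarMatrix_nonneg' k M _ := by
    have : M.map (0 : A →ₗ[ℂ] B) = 0 := by ext; rfl
    exact this.ge

/-- A finite sum of completely positive maps. -/
def cpSum {ι : Type*} (s : Finset ι) (φ : ι → A →CP B) : A →CP B where
  toLinearMap := ∑ i ∈ s, (φ i).toLinearMap
  map_cstarMatrix_nonneg' k M hM := by
    have : M.map (∑ i ∈ s, (φ i).toLinearMap : A →ₗ[ℂ] B) =
        ∑ i ∈ s, M.map (φ i).toLinearMap := by
      classical
      induction s using Finset.induction_on with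
      | empty => rw [Finset.sum_empty, Finset.sum_empty]; ext; rfl
      | insert i s hi ih => rw [Finset.sum_insert hi, Finset.sum_insert hi, ← ih]; ext; rfl
    exact this ▸ Finset.sum_nonneg fun i _ => (φ i).map_cstarMatrix_nonneg' k M hM

theorem cpSum_apply {ι : Type*} (s : Finset ι) (φ : ι → A →CP B) (a : A) :
    cpSum s φ a = ∑ i ∈ s, φ i a :=
  LinearMap.sum_apply _ _ _

/-- The composition of completely positive maps. -/
def cpComp (ψ : B →CP C) (φ : A →CP B) : A →CP C where
  toLinearMap := ψ.toLinearMap ∘ₗ φ.toLinearMap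
  map_cstarMatrix_nonneg' k M hM :=
    ψ.map_cstarMatrix_nonneg' k _ (φ.map_cstarMatrix_nonneg' k M hM)

theorem cp_map_nonneg (φ : A →CP B) {a : A} (ha : 0 ≤ a) : 0 ≤ φ a := map_nonneg φ ha

theorem cp_norm_le (φ : A →CP B) (a : A) : ‖φ a‖ ≤ 2 * ‖φ 1‖ * ‖a‖ :=
  norm_le_of_map_nonneg φ.toLinearMap (fun _ ha => cp_map_nonneg φ ha) a

theorem cp_map_star (φ : A →CP B) (a : A) : φ (star a) = star (φ a) := map_star φ a

variable {H : Type*} [NormedAddCommGroup H] [InnerProductSpace ℂ H] [CompleteSpace H]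

/-- The map `a ↦ (⟪ξ i, π(a) ξ j⟫)` as a linear map. -/
def vectorLin (π : A →⋆ₐ[ℂ] (H →L[ℂ] H)) {k : ℕ} (ξ : Fin k → H) : A →ₗ[ℂ] Mat k where
  toFun a := CStarMatrix.ofMatrix fun i j => ⟪ξ i, π a (ξ j)⟫_ℂ
  map_add' a b := by
    ext i j
    simp only [map_add, add_apply, inner_add_right]
    rfl
  map_smul' c a := by
    ext i j
    simp only [map_smul, smul_apply, inner_smul_right, RingHom.id_apply]
    rfl

theorem vectorLin_apply {A : Type*} [CStarAlgebra A] (π : A →⋆ₐ[ℂ] (H →L[ℂ] H)) {k : ℕ}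
    (ξ : Fin k → H) (a : A) (i j : Fin k) :
    vectorLin π ξ a i j = ⟪ξ i, π a (ξ j)⟫_ℂ := rfl

theorem vectorLin_star {A : Type*} [CStarAlgebra A]
    (π : A →⋆ₐ[ℂ] (H →L[ℂ] H)) {k : ℕ} (ξ : Fin k → H) (a : A) :
    vectorLin π ξ (star a) = star (vectorLin π ξ a) := by
  ext i j
  rw [CStarMatrix.star_apply, vectorLin_apply, vectorLin_apply, map_star,
    ContinuousLinearMap.star_eq_adjoint, ContinuousLinearMap.adjoint_inner_right,
    RCLike.star_def, inner_conj_symm]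

/-- The quadratic form of a matrix at the vector `z`, as a linear functional of the matrix. -/
def quadForm {k : ℕ} (z : Fin k → ℂ) : Mat k →ₗ[ℂ] ℂ where
  toFun X := ∑ s, ∑ t, star (z s) * X s t * z t
  map_add' X Y := by
    simp only [CStarMatrix.add_apply, mul_add, add_mul, Finset.sum_add_distrib]
  map_smul' c X := by
    simp only [CStarMatrix.smul_apply, smul_eq_mul, RingHom.id_apply, Finset.mul_sum]
    refine Finset.sum_congr rfl fun s _ => Finset.sum_congr rfl fun t _ => ?_
    ring

theorem quadForm_star_mul_mul {k : ℕ} (z : Fin k → ℂ) (a N b : Mat k) :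
    quadForm z (star a * N * b) =
      ∑ i, ∑ j, star (∑ s, a i s * z s) * N i j * (∑ t, b j t * z t) := by
  have h (w w' : Fin k → ℂ) (X : Matrix (Fin k) (Fin k) ℂ) :
      ∑ i, ∑ j, star (w i) * X i j * w' j = star w ⬝ᵥ X.mulVec w' := by
    simp only [dotProduct, Matrix.mulVec, Finset.mul_sum, Pi.star_apply, mul_assoc]
  refine (h z z ((CStarMatrix.ofMatrix.symm a).conjTranspose * CStarMatrix.ofMatrix.symm N *
    CStarMatrix.ofMatrix.symm b)).trans (Eq.trans ?_
      (h ((CStarMatrix.ofMatrix.symm a).mulVec z) ((CStarMatrix.ofMatrix.symm b).mulVec z)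
        (CStarMatrix.ofMatrix.symm N)).symm)
  rw [Matrix.star_mulVec, ← Matrix.dotProduct_mulVec, Matrix.mulVec_mulVec, Matrix.mulVec_mulVec,
    mul_assoc]

theorem sum_star_mul_sum_inner_mul {ι κ ρ H : Type*} [Fintype ι] [Fintype κ] [Fintype ρ]
    [NormedAddCommGroup H] [InnerProductSpace ℂ H] (w : ι → κ → ℂ) (η : ρ → ι → κ → H) :
    ∑ p, ∑ q, ∑ i, ∑ j, star (w p i) * (∑ r, ⟪η r p i, η r q j⟫_ℂ) * w q j =
      ∑ r, ⟪∑ p, ∑ i, w p i • η r p i, ∑ p, ∑ i, w p i • η r p i⟫_ℂ := by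
  have h (r : ρ) : ⟪∑ p, ∑ i, w p i • η r p i, ∑ p, ∑ i, w p i • η r p i⟫_ℂ =
      ∑ p, ∑ q, ∑ i, ∑ j, star (w p i) * ⟪η r p i, η r q j⟫_ℂ * w q j := by
    rw [sum_inner]
    refine Finset.sum_congr rfl fun p _ => ?_
    rw [inner_sum]
    refine Finset.sum_congr rfl fun q _ => ?_
    rw [sum_inner]
    refine Finset.sum_congr rfl fun i _ => ?_
    rw [inner_sum]
    refine Finset.sum_congr rfl fun j _ => ?_
    rw [inner_smul_left, inner_smul_right, RCLike.star_def]
    ring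
  simp only [h, Finset.mul_sum, Finset.sum_mul]
  symm
  rw [Finset.sum_comm]
  refine Finset.sum_congr rfl fun p _ => ?_
  rw [Finset.sum_comm]
  refine Finset.sum_congr rfl fun q _ => ?_
  rw [Finset.sum_comm]
  refine Finset.sum_congr rfl fun i _ => ?_
  rw [Finset.sum_comm]

theorem quadForm_sum_vectorLin {A : Type*} [CStarAlgebra A]
    (π : A →⋆ₐ[ℂ] (H →L[ℂ] H)) {k m : ℕ} (ξ : Fin k → H)
    (d : Fin m → Fin m → A) (v : Fin m → Mat k) (z : Fin k → ℂ) :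
    quadForm z (∑ p, ∑ q, star (v p) * vectorLin π ξ (∑ r, star (d r p) * d r q) * v q) =
      ∑ r, ⟪∑ p, ∑ i, (∑ s, v p i s * z s) • π (d r p) (ξ i),
        ∑ p, ∑ i, (∑ s, v p i s * z s) • π (d r p) (ξ i)⟫_ℂ := by
  have hN (p q : Fin m) (i j : Fin k) : vectorLin π ξ (∑ r, star (d r p) * d r q) i j =
      ∑ r, ⟪π (d r p) (ξ i), π (d r q) (ξ j)⟫_ℂ := by
    rw [vectorLin_apply, map_sum, sum_apply, inner_sum]
    refine Finset.sum_congr rfl fun r _ => ?_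
    rw [map_mul, mul_apply_eq_comp, map_star, ContinuousLinearMap.star_eq_adjoint,
      ContinuousLinearMap.adjoint_inner_right]
  have h := sum_star_mul_sum_inner_mul (fun p i => ∑ s, v p i s * z s)
    (fun r p i => π (d r p) (ξ i))
  have h' (p q : Fin m) :
      quadForm z (star (v p) * vectorLin π ξ (∑ r, star (d r p) * d r q) * v q) =
        ∑ i, ∑ j, star (∑ s, v p i s * z s) * (∑ r, ⟪π (d r p) (ξ i), π (d r q) (ξ j)⟫_ℂ) *
          (∑ t, v q j t * z t) := by
    rw [quadForm_star_mul_mul]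
    refine Finset.sum_congr rfl fun i _ => Finset.sum_congr rfl fun j _ => ?_
    rw [hN]
  have h'' : quadForm z (∑ p, ∑ q, star (v p) * vectorLin π ξ (∑ r, star (d r p) * d r q) * v q) =
      ∑ p, ∑ q, quadForm z (star (v p) * vectorLin π ξ (∑ r, star (d r p) * d r q) * v q) := by
    rw [map_sum]
    refine Finset.sum_congr rfl fun p _ => ?_
    rw [map_sum]
  rw [h'', ← h]
  exact Finset.sum_congr rfl fun p _ => Finset.sum_congr rfl fun q _ => h' p q

/-- A vector map `a ↦ (⟪ξ i, π(a) ξ j⟫)` is completely positive. -/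
def vectorCP (π : A →⋆ₐ[ℂ] (H →L[ℂ] H)) {k : ℕ} (ξ : Fin k → H) : A →CP Mat k where
  toLinearMap := vectorLin π ξ
  map_cstarMatrix_nonneg' m M hM := by
    have hs : IsSelfAdjoint (M.map (vectorLin π ξ)) :=
      CStarMatrix.isSelfAdjoint_map _ (vectorLin_star π ξ) (IsSelfAdjoint.of_nonneg hM)
    -- The positivity test is applied twice: over the algebra of k × k matrices with v, then over ℂ
    -- with z. What remains is a sum of squared norms of vectors.
    refine CStarMatrix.nonneg_of_sum_star_mul_mul_nonneg hs fun v => ?_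
    have hs' : IsSelfAdjoint (∑ p, ∑ q, star (v p) * M.map (vectorLin π ξ) p q * v q) := by
      rw [isSelfAdjoint_iff, star_sum]
      simp only [star_sum, star_mul, star_star]
      rw [Finset.sum_comm]
      refine Finset.sum_congr rfl fun p _ => Finset.sum_congr rfl fun q _ => ?_
      rw [CStarMatrix.star_apply_of_isSelfAdjoint hs, mul_assoc]
    refine CStarMatrix.nonneg_of_sum_star_mul_mul_nonneg hs' fun z => ?_
    obtain ⟨D, rfl⟩ := exists_eq_star_mul_self_of_nonneg hM
    refine le_of_le_of_eq ?_ (quadForm_sum_vectorLin π ξ (fun r p => D r p) v z).symm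
    exact Finset.sum_nonneg fun r _ => by
      rw [inner_self_eq_norm_sq_to_K]
      positivity

theorem vectorCP_apply (π : A →⋆ₐ[ℂ] (H →L[ℂ] H)) {k : ℕ} (ξ : Fin k → H) (a : A) (i j : Fin k) :
    vectorCP π ξ a i j = ⟪ξ i, π a (ξ j)⟫_ℂ := rfl

end CP

/-! ### Decomposition of real functionals into positive ones -/

section Jordan

variable {A : Type*} [CStarAlgebra A] [PartialOrder A] [StarOrderedRing A]

/-- M. Riesz extension on pairs (p₁, p₂), ordered by the cone of pairs of positive elements. The
functional f(p₁ - p₂) + c φ₀(p₁ + p₂) is positive on the subspace where p₁ + p₂ is scalar. A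
positive extension G, restricted to the two coordinates, gives the two summands up to the factor
1/2, since f(a) = G(a, -a)/2. -/
theorem exists_positive_sub_positive (f : selfAdjoint A →ₗ[ℝ] ℝ) {c : ℝ}
    (hf : ∀ a : selfAdjoint A, |f a| ≤ c * ‖(a : A)‖) :
    ∃ g₁ g₂ : selfAdjoint A →ₗ[ℝ] ℝ, (∀ a : selfAdjoint A, 0 ≤ (a : A) → 0 ≤ g₁ a) ∧
      (∀ a : selfAdjoint A, 0 ≤ (a : A) → 0 ≤ g₂ a) ∧ f = g₁ - g₂ := by
  rcases subsingleton_or_nontrivial A with hA | hA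
  · refine ⟨0, 0, fun _ _ => le_rfl, fun _ _ => le_rfl, ?_⟩
    ext a
    rw [Subsingleton.elim a 0]
    simp
  -- Only the value of φ₀ on scalars matters; its positivity plays no role.
  obtain ⟨φ, -, hφ⟩ := exists_dual_vector ℂ (1 : A) (norm_ne_zero_iff.mpr one_ne_zero)
  let φ₀ : selfAdjoint A →ₗ[ℝ] ℝ :=
    Complex.reLm ∘ₗ (φ.toLinearMap.restrictScalars ℝ) ∘ₗ (selfAdjoint.submodule ℝ A).subtype
  have hφ₀ (r : ℝ) (a : selfAdjoint A) (ha : (a : A) = algebraMap ℝ A r) : φ₀ a = r := by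
    change (φ (a : A)).re = r
    rw [ha, Algebra.algebraMap_eq_smul_one, ← Complex.coe_smul, map_smul, hφ]
    simp
  let E := selfAdjoint A × selfAdjoint A
  let s : PointedCone ℝ E :=
    { carrier := {p | 0 ≤ (p.1 : A) ∧ 0 ≤ (p.2 : A)}
      zero_mem' := ⟨le_rfl, le_rfl⟩
      smul_mem' := fun r p hp => ⟨smul_nonneg r.2 hp.1, smul_nonneg r.2 hp.2⟩
      add_mem' := fun hp hq => ⟨add_nonneg hp.1 hq.1, add_nonneg hp.2 hq.2⟩ }
  let D : Submodule ℝ E :=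
    { carrier := {p | ∃ r : ℝ, (p.1 : A) + p.2 = algebraMap ℝ A r}
      zero_mem' := ⟨0, by simp⟩
      smul_mem' := by
        rintro r p ⟨t, ht⟩
        refine ⟨r * t, ?_⟩
        change r • (p.1 : A) + r • (p.2 : A) = _
        rw [← smul_add, ht, map_mul, Algebra.smul_def]
      add_mem' := by
        rintro p q ⟨t, ht⟩ ⟨t', ht'⟩
        refine ⟨t + t', ?_⟩
        change (p.1 + q.1 : A) + (p.2 + q.2 : A) = _
        rw [map_add, ← ht, ← ht']
        abel }
  let F : E →ₗ[ℝ] ℝ := f.comp (LinearMap.fst ℝ _ _ - LinearMap.snd ℝ _ _) +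
    c • φ₀.comp (LinearMap.fst ℝ _ _ + LinearMap.snd ℝ _ _)
  have hF (p : E) : F p = f (p.1 - p.2) + c * φ₀ (p.1 + p.2) := rfl
  have hpos : ∀ x : (F.toPMap D).domain, (x : E) ∈ s → 0 ≤ F.toPMap D x := by
    rintro ⟨p, r, hr⟩ ⟨hp1, hp2⟩
    change 0 ≤ F p
    have hr0 : 0 ≤ r := by
      have h : 0 ≤ algebraMap ℝ A r := hr ▸ add_nonneg hp1 hp2
      by_contra! hr'
      have h' : 0 ≤ algebraMap ℝ A (-r) := algebraMap_nonneg A (by linarith)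
      rw [map_neg, neg_nonneg] at h'
      have h0 := le_antisymm h' h
      rw [map_eq_zero] at h0
      exact hr'.ne h0
    rw [hF, hφ₀ r _ hr]
    -- If p₁, p₂ ≥ 0 and p₁ + p₂ = r, then -r ≤ p₁ - p₂ ≤ r; hence f(p₁ - p₂) ≥ -cr.
    have hn : ‖((p.1 - p.2 : selfAdjoint A) : A)‖ ≤ r := by
      refine norm_le_of_neg_le_of_le hr0 ?_ ?_
      · rw [← hr, ← sub_nonneg]
        have : (p.1 + p.2 - (p.1 - p.2 : selfAdjoint A) : A) = p.2 + p.2 := by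
          push_cast
          abel
        rw [this]
        exact add_nonneg hp2 hp2
      · rw [← hr, ← sub_nonneg]
        have : ((p.1 - p.2 : selfAdjoint A) - -(p.1 + p.2) : A) = p.1 + p.1 := by
          push_cast
          abel
        rw [this]
        exact add_nonneg hp1 hp1
    have hc : 0 ≤ c := by
      have := (abs_nonneg _).trans (hf 1)
      simpa using this
    have := (abs_le.mp ((hf (p.1 - p.2)).trans (mul_le_mul_of_nonneg_left hn hc))).1
    linarith
  have hdense : ∀ y : E, ∃ x : (F.toPMap D).domain, (x : E) + y ∈ s := by
    intro y
    have hsa (a : selfAdjoint A) : 0 ≤ algebraMap ℝ A ‖(a : A)‖ + a := by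
      have := a.2.neg_algebraMap_norm_le_self
      rwa [neg_le_iff_add_nonneg'] at this
    refine ⟨⟨(⟨algebraMap ℝ A ‖(y.1 : A)‖, .algebraMap A (.all _)⟩,
      ⟨algebraMap ℝ A ‖(y.2 : A)‖, .algebraMap A (.all _)⟩), ⟨‖(y.1 : A)‖ + ‖(y.2 : A)‖, ?_⟩⟩, ?_⟩
    · rw [map_add]
    · exact ⟨hsa y.1, hsa y.2⟩
  obtain ⟨G, hG, hG0⟩ := riesz_extension s (F.toPMap D) hpos hdense
  refine ⟨(2 : ℝ)⁻¹ • G.comp (LinearMap.inl ℝ _ _), (2 : ℝ)⁻¹ • G.comp (LinearMap.inr ℝ _ _),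
    ?_, ?_, ?_⟩
  · intro a ha
    exact mul_nonneg (by norm_num) (hG0 _ ⟨ha, le_rfl⟩)
  · intro a ha
    exact mul_nonneg (by norm_num) (hG0 _ ⟨le_rfl, ha⟩)
  · ext a
    have h := hG ⟨(a, -a), ⟨0, by simp⟩⟩
    have h1 : G (a, -a) = G (a, 0) - G (0, a) := by
      rw [← map_sub]
      exact congrArg G (Prod.ext (sub_zero a).symm (zero_sub a).symm)
    have h2 : F (a, -a) = 2 * f a := by
      rw [hF]
      simp [← two_mul]
    change _ = (2 : ℝ)⁻¹ * G (a, 0) - (2 : ℝ)⁻¹ * G (0, a)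
    have h3 : G (a, -a) = F (a, -a) := h
    rw [h1, h2] at h3
    linarith

/-- The complex-linear extension of a real functional on the self-adjoint part. -/
def complexExtend (g : selfAdjoint A →ₗ[ℝ] ℝ) : A →ₗ[ℂ] ℂ where
  toFun a := g (realPart a) + Complex.I * g (imaginaryPart a)
  map_add' a b := by
    simp only [map_add, Complex.ofReal_add]
    ring
  map_smul' z a := by
    simp only [realPart_smul, imaginaryPart_smul, map_sub, map_add, map_smul, smul_eq_mul,
      RingHom.id_apply, Complex.ofReal_sub, Complex.ofReal_add, Complex.ofReal_mul]
    conv_rhs => rw [← Complex.re_add_im z]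
    linear_combination (-(z.im : ℂ) * g (imaginaryPart a)) * Complex.I_mul_I

theorem complexExtend_apply_coe {A : Type*} [CStarAlgebra A] (g : selfAdjoint A →ₗ[ℝ] ℝ)
    (a : selfAdjoint A) :
    complexExtend g a = g a := by
  change (g (realPart (a : A)) : ℂ) + Complex.I * g (imaginaryPart (a : A)) = g a
  rw [selfAdjoint.realPart_coe, selfAdjoint.imaginaryPart_coe]
  simp

theorem linearMap_ext_selfAdjoint {A : Type*} [CStarAlgebra A] {f g : A →ₗ[ℂ] ℂ}
    (h : ∀ a : selfAdjoint A, f a = g a) : f = g := by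
  ext a
  rw [← realPart_add_I_smul_imaginaryPart a, map_add, map_add, map_smul, map_smul, h, h]

/-- A positive functional from one on the self-adjoint part. -/
def positiveExtend (g : selfAdjoint A →ₗ[ℝ] ℝ)
    (hg : ∀ a : selfAdjoint A, 0 ≤ (a : A) → 0 ≤ g a) : A →ₚ[ℂ] ℂ :=
  PositiveLinearMap.mk₀ (complexExtend g) fun a ha => by
    have := complexExtend_apply_coe g ⟨a, IsSelfAdjoint.of_nonneg ha⟩
    rw [this]
    exact_mod_cast hg _ ha

end Jordan

/-! ### The bidual acting on the universal Hilbert space -/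

section Universal

variable {A : Type u} [CStarAlgebra A] [PartialOrder A] [StarOrderedRing A]

/-- The vector functional `a ↦ ⟪ξ, π(a) η⟫` of the universal representation. -/
def vectorFunctional (ξ η : UniversalSpace A) : StrongDual ℂ A :=
  LinearMap.mkContinuous
    { toFun := fun a => ⟪ξ, universalRep A a η⟫_ℂ
      map_add' := fun a b => by rw [map_add, add_apply, inner_add_right]
      map_smul' := fun c a => by
        rw [map_smul, smul_apply, inner_smul_right, RingHom.id_apply, smul_eq_mul] }
    (‖ξ‖ * ‖η‖) fun a => by
      refine (norm_inner_le_norm (𝕜 := ℂ) ξ (universalRep A a η)).trans ?_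
      have h1 := (universalRep A a).le_opNorm η
      have h2 := NonUnitalStarAlgHom.norm_apply_le (universalRep A) a
      calc ‖ξ‖ * ‖universalRep A a η‖ ≤ ‖ξ‖ * (‖a‖ * ‖η‖) := by gcongr; exact h1.trans (by gcongr)
        _ = _ := by ring

theorem vectorFunctional_apply (ξ η : UniversalSpace A) (a : A) :
    vectorFunctional ξ η a = ⟪ξ, universalRep A a η⟫_ℂ := rfl

theorem norm_vectorFunctional_le (ξ η : UniversalSpace A) :
    ‖vectorFunctional ξ η‖ ≤ ‖ξ‖ * ‖η‖ :=
  LinearMap.mkContinuous_norm_le _ (by positivity) _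

theorem inner_gns_one (φ : A →ₚ[ℂ] ℂ) (a : A) :
    ⟪(φ.toPreGNS 1 : φ.GNS), φ.gnsStarAlgHom a (φ.toPreGNS 1 : φ.GNS)⟫_ℂ = φ a := by
  have h : φ.gnsStarAlgHom a (φ.toPreGNS 1 : φ.GNS) =
      (φ.leftMulMapPreGNS a (φ.toPreGNS 1) : φ.GNS) :=
    PositiveLinearMap.gnsNonUnitalStarAlgHom_apply_coe φ
  rw [h, UniformSpace.Completion.inner_coe, PositiveLinearMap.preGNS_inner_def]
  simp

theorem exists_vectorFunctional_eq_of_state (φ : State A) :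
    ∃ ξ : UniversalSpace A, ∀ a, vectorFunctional ξ ξ a = φ.1 a := by
  classical
  refine ⟨lp.single 2 φ (φ.1.toPreGNS 1 : φ.1.GNS), fun a => ?_⟩
  rw [vectorFunctional_apply, lp.inner_single_left]
  refine Eq.trans ?_ (inner_gns_one φ.1 a)
  congr 1
  refine (universalOp_apply a _ φ).trans ?_
  rw [lp.single_apply_self]

theorem exists_vectorFunctional_eq_of_positive (φ : A →ₚ[ℂ] ℂ) :
    ∃ ξ : UniversalSpace A, ∃ c : ℂ, ∀ a, φ a = c * vectorFunctional ξ ξ a := by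
  have h0 : 0 ≤ φ 1 := map_nonneg φ zero_le_one
  by_cases h1 : φ 1 = 0
  -- Normalization is impossible when φ(1) = 0, but then the GNS vector is zero, and so is φ.
  · refine ⟨0, 0, fun a => ?_⟩
    have key : ⟪(φ.toPreGNS 1 : φ.GNS), (φ.toPreGNS 1 : φ.GNS)⟫_ℂ = 0 := by
      rw [UniformSpace.Completion.inner_coe, PositiveLinearMap.preGNS_inner_def]
      simpa using h1
    rw [← inner_gns_one, inner_self_eq_zero.mp key]
    simp
  · have hinv : 0 ≤ (φ 1)⁻¹ := inv_nonneg.mpr h0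
    let ψ : A →ₚ[ℂ] ℂ := PositiveLinearMap.mk₀ ((φ 1)⁻¹ • φ.toLinearMap) fun a ha =>
      mul_nonneg hinv (map_nonneg φ ha)
    obtain ⟨ξ, hξ⟩ := exists_vectorFunctional_eq_of_state (⟨ψ, inv_mul_cancel₀ h1⟩ : State A)
    refine ⟨ξ, φ 1, fun a => ?_⟩
    rw [hξ]
    exact (mul_inv_cancel_left₀ h1 (φ a)).symm

theorem vectorFunctional_add_left (ξ ξ' η : UniversalSpace A) :
    vectorFunctional (ξ + ξ') η = vectorFunctional ξ η + vectorFunctional ξ' η :=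
  ContinuousLinearMap.ext fun a => inner_add_left (𝕜 := ℂ) ξ ξ' (universalRep A a η)

theorem vectorFunctional_smul_left (c : ℂ) (ξ η : UniversalSpace A) :
    vectorFunctional (c • ξ) η = starRingEnd ℂ c • vectorFunctional ξ η :=
  ContinuousLinearMap.ext fun a => inner_smul_left (𝕜 := ℂ) ξ (universalRep A a η) c

theorem vectorFunctional_add_right (ξ η η' : UniversalSpace A) :
    vectorFunctional ξ (η + η') = vectorFunctional ξ η + vectorFunctional ξ η' :=
  ContinuousLinearMap.ext fun a => by
    rw [vectorFunctional_apply, map_add, inner_add_right]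
    rfl

theorem vectorFunctional_smul_right (c : ℂ) (ξ η : UniversalSpace A) :
    vectorFunctional ξ (c • η) = c • vectorFunctional ξ η :=
  ContinuousLinearMap.ext fun a => by
    rw [vectorFunctional_apply, map_smul, inner_smul_right]
    rfl

/-- Every bounded functional on `A` is a linear combination of vector functionals of the universal
representation. -/
theorem mem_span_vectorFunctional (f : StrongDual ℂ A) :
    f ∈ Submodule.span ℂ {g | ∃ ξ η : UniversalSpace A, g = vectorFunctional ξ η} := by
  have hpos (u : selfAdjoint A →ₗ[ℝ] ℝ) {c : ℝ} (hu : ∀ a : selfAdjoint A, |u a| ≤ c * ‖(a : A)‖) :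
      ∃ g ∈ Submodule.span ℂ {g | ∃ ξ η : UniversalSpace A, g = vectorFunctional ξ η},
        ∀ a : selfAdjoint A, g a = u a := by
    obtain ⟨g₁, g₂, h₁, h₂, rfl⟩ := exists_positive_sub_positive u hu
    obtain ⟨ξ₁, c₁, hc₁⟩ := exists_vectorFunctional_eq_of_positive (positiveExtend g₁ h₁)
    obtain ⟨ξ₂, c₂, hc₂⟩ := exists_vectorFunctional_eq_of_positive (positiveExtend g₂ h₂)
    refine ⟨c₁ • vectorFunctional ξ₁ ξ₁ - c₂ • vectorFunctional ξ₂ ξ₂,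
      sub_mem (Submodule.smul_mem _ _ (Submodule.subset_span ⟨_, _, rfl⟩))
        (Submodule.smul_mem _ _ (Submodule.subset_span ⟨_, _, rfl⟩)), fun a => ?_⟩
    have e₁ : (g₁ a : ℂ) = c₁ * vectorFunctional ξ₁ ξ₁ a :=
      (complexExtend_apply_coe g₁ a).symm.trans (hc₁ a)
    have e₂ : (g₂ a : ℂ) = c₂ * vectorFunctional ξ₂ ξ₂ a :=
      (complexExtend_apply_coe g₂ a).symm.trans (hc₂ a)
    rw [LinearMap.sub_apply, Complex.ofReal_sub, e₁, e₂]
    rfl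
  let incl : selfAdjoint A →ₗ[ℝ] ℂ :=
    f.toLinearMap.restrictScalars ℝ ∘ₗ (selfAdjoint.submodule ℝ A).subtype
  obtain ⟨g, hg, hgu⟩ := hpos (Complex.reLm ∘ₗ incl) (c := ‖f‖) fun a =>
    (Complex.abs_re_le_norm _).trans (f.le_opNorm a)
  obtain ⟨h, hh, hhu⟩ := hpos (Complex.imLm ∘ₗ incl) (c := ‖f‖) fun a =>
    (Complex.abs_im_le_norm _).trans (f.le_opNorm a)
  have key : f = g + Complex.I • h := by
    apply ContinuousLinearMap.coe_injective
    refine linearMap_ext_selfAdjoint fun a => ?_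
    change f a = g a + Complex.I * h a
    rw [hgu, hhu]
    change f a = ((f a).re : ℂ) + Complex.I * (f a).im
    rw [mul_comm, Complex.re_add_im]
  rw [key]
  exact add_mem hg (Submodule.smul_mem _ _ hh)

/-- The sesquilinear form of an element of the bidual on the universal Hilbert space. -/
def bidualForm (x : StrongDual ℂ (StrongDual ℂ A)) :
    UniversalSpace A →L⋆[ℂ] UniversalSpace A →L[ℂ] ℂ :=
  LinearMap.mkContinuous₂
    (LinearMap.mk₂'ₛₗ (starRingEnd ℂ) (RingHom.id ℂ) (fun ξ η => x (vectorFunctional ξ η))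
      (fun ξ ξ' η => by rw [← map_add, vectorFunctional_add_left])
      (fun c ξ η => by rw [← map_smul, vectorFunctional_smul_left])
      (fun ξ η η' => by rw [← map_add, vectorFunctional_add_right])
      (fun c ξ η => by rw [← map_smul, vectorFunctional_smul_right, RingHom.id_apply]))
    ‖x‖ fun ξ η => by
      refine (x.le_opNorm _).trans ?_
      rw [mul_assoc]
      gcongr
      exact norm_vectorFunctional_le ξ η

/-- The operator on the universal Hilbert space defined by an element of the bidual. -/
def bidualOp (x : StrongDual ℂ (StrongDual ℂ A)) : UniversalSpace A →L[ℂ] UniversalSpace A :=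
  ContinuousLinearMap.adjoint (InnerProductSpace.continuousLinearMapOfBilin (bidualForm x))

theorem inner_bidualOp (x : StrongDual ℂ (StrongDual ℂ A)) (ξ η : UniversalSpace A) :
    ⟪ξ, bidualOp x η⟫_ℂ = x (vectorFunctional ξ η) := by
  rw [bidualOp, ContinuousLinearMap.adjoint_inner_right,
    InnerProductSpace.continuousLinearMapOfBilin_apply]
  rfl

/-- If S commutes with π(A), the vector functionals of (S⋆ξ, η) and (ξ, Sη) coincide, so evaluating
x on them shows that S commutes with the operator of x. -/
theorem bidualOp_mem_enveloping (x : StrongDual ℂ (StrongDual ℂ A)) :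
    bidualOp x ∈ enveloping A := by
  have h : bidualOp x ∈ (enveloping A : Set (UniversalSpace A →L[ℂ] UniversalSpace A)) := by
    rw [coe_enveloping, Set.mem_centralizer_iff]
    intro S hS
    refine ContinuousLinearMap.ext fun η => ext_inner_left ℂ fun ξ => ?_
    rw [mul_apply_eq_comp, mul_apply_eq_comp, ← ContinuousLinearMap.adjoint_inner_left,
      inner_bidualOp, inner_bidualOp]
    congr 1
    ext a
    rw [vectorFunctional_apply, vectorFunctional_apply, ContinuousLinearMap.adjoint_inner_left,
      ← mul_apply_eq_comp, ← mul_apply_eq_comp, Set.mem_centralizer_iff.mp hS _ ⟨a, rfl⟩]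
  exact h

theorem bidualOp_inclusion (a : A) :
    bidualOp (NormedSpace.inclusionInDoubleDual ℂ A a) = universalRep A a := by
  refine ContinuousLinearMap.ext fun η => ext_inner_left ℂ fun ξ => ?_
  rw [inner_bidualOp]
  rfl

end Universal

/-! ### From weak-⋆ to norm approximation in local reflexivity -/

section Approximation

variable {A : Type u} [CStarAlgebra A] [PartialOrder A] [StarOrderedRing A]

theorem norm_convexCombination_le {V : Type*} [NormedAddCommGroup V] [NormedSpace ℂ V] {v w : V}
    {r : ℝ} (hv : ‖v‖ ≤ r) (hw : ‖w‖ ≤ r) {a b : ℝ} (ha : 0 ≤ a) (hb : 0 ≤ b) (hab : a + b = 1) :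
    ‖(a : ℂ) • v + (b : ℂ) • w‖ ≤ r := by
  refine (norm_add_le _ _).trans ?_
  rw [norm_smul, norm_smul, Complex.norm_real, Complex.norm_real, Real.norm_of_nonneg ha,
    Real.norm_of_nonneg hb]
  calc a * ‖v‖ + b * ‖w‖ ≤ a * r + b * r :=
        add_le_add (mul_le_mul_of_nonneg_left hv ha) (mul_le_mul_of_nonneg_left hw hb)
    _ = r := by rw [← add_mul, hab, one_mul]

theorem IsContractiveCP.convexCombination
    {X : Submodule ℂ (UniversalSpace A →L[ℂ] UniversalSpace A)} {α β : X →ₗ[ℂ] A}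
    (hα : IsContractiveCP α) (hβ : IsContractiveCP β) {a b : ℝ} (ha : 0 ≤ a) (hb : 0 ≤ b)
    (hab : a + b = 1) : IsContractiveCP ((a : ℂ) • α + (b : ℂ) • β) where
  map_cstarMatrix_nonneg k M hM :=
    add_nonneg (complex_smul_nonneg (hα.map_cstarMatrix_nonneg k M hM) ha)
      (complex_smul_nonneg (hβ.map_cstarMatrix_nonneg k M hM) hb)
  contractive x := by
    exact norm_convexCombination_le (hα.contractive x) (hβ.contractive x) ha hb hab

theorem tendsto_of_tendsto_vectorFunctional
    {X : Submodule ℂ (UniversalSpace A →L[ℂ] UniversalSpace A)} {I : Type*} {l : Filter I}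
    {α : I → X →ₗ[ℂ] A}
    (h : ∀ (x : X) (ξ η : UniversalSpace A),
      Tendsto (fun i => ⟪ξ, universalRep A (α i x) η⟫_ℂ) l
        (𝓝 ⟪ξ, (x : UniversalSpace A →L[ℂ] UniversalSpace A) η⟫_ℂ))
    (y : StrongDual ℂ (StrongDual ℂ A)) (hy : bidualOp y ∈ X) (f : StrongDual ℂ A) :
    Tendsto (fun i => f (α i ⟨bidualOp y, hy⟩)) l (𝓝 (y f)) := by
  induction mem_span_vectorFunctional f using Submodule.span_induction with
  | mem g hg =>
    obtain ⟨ξ, η, rfl⟩ := hg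
    rw [← inner_bidualOp]
    exact h _ ξ η
  | zero => simpa using tendsto_const_nhds
  | add g g' _ _ h₁ h₂ => simpa using h₁.add h₂
  | smul c g _ h₁ => simpa using h₁.const_mul c

/-- Mazur's argument: contractive completely positive maps form a convex set, so its image S in Aᶥ ×
ℂ, recording the values at the c's and f of the value at y, has the same weak and norm closure. The
net from local reflexivity puts (c, y(f)) in the weak closure. -/
theorem exists_contractiveCP_approx (hA : IsLocallyReflexive A)
    {X : Submodule ℂ (UniversalSpace A →L[ℂ] UniversalSpace A)} (hX : IsFinDimOperatorSystem A X)
    {ι : Type*} [Fintype ι] (c : ι → A) (hc : ∀ i, universalRep A (c i) ∈ X)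
    (y : StrongDual ℂ (StrongDual ℂ A)) (hy : bidualOp y ∈ X) (f : StrongDual ℂ A)
    {ε : ℝ} (hε : 0 < ε) :
    ∃ α : X →ₗ[ℂ] A, IsContractiveCP α ∧ (∀ i, ‖α ⟨universalRep A (c i), hc i⟩ - c i‖ < ε) ∧
      ‖f (α ⟨bidualOp y, hy⟩) - y f‖ < ε := by
  classical
  let P : (X →ₗ[ℂ] A) →ₗ[ℂ] (ι → A) × ℂ :=
    { toFun := fun α => (fun i => α ⟨universalRep A (c i), hc i⟩, f (α ⟨bidualOp y, hy⟩))
      map_add' := fun α β => Prod.ext rfl (map_add f _ _)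
      map_smul' := fun r α => Prod.ext rfl (map_smul f r _) }
  let S : Set ((ι → A) × ℂ) := {p | ∃ α, IsContractiveCP α ∧ P α = p}
  have hsmul (r : ℝ) (v : (ι → A) × ℂ) : (r : ℂ) • v = r • v :=
    Prod.ext (funext fun i => Complex.coe_smul r (v.1 i)) (Complex.coe_smul r v.2)
  have hconv : Convex ℝ S := by
    rintro _ ⟨α, hα, rfl⟩ _ ⟨β, hβ, rfl⟩ a b ha hb hab
    refine ⟨_, hα.convexCombination hβ ha hb hab, ?_⟩
    exact (P.map_add _ _).trans (congrArg₂ (· + ·) ((P.map_smul _ _).trans (hsmul a (P α)))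
      ((P.map_smul _ _).trans (hsmul b (P β))))
  have hmem : ((c, y f) : (ι → A) × ℂ) ∈ closure S := by
    by_contra hnot
    obtain ⟨g, u, hg, hu⟩ := RCLike.geometric_hahn_banach_closed_point (𝕜 := ℂ) hconv.closure
      isClosed_closure hnot
    obtain ⟨I, _, _, _, α, hα, hlim⟩ := hA X hX
    -- Coordinatewise, g consists of functionals on A, to which the weak-⋆ convergence of the net
    -- applies.
    have hdec (v : ι → A) (z : ℂ) : g (v, z) =
        ∑ i, (g ∘L ContinuousLinearMap.inl ℂ (ι → A) ℂ ∘L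
          ContinuousLinearMap.single ℂ (fun _ : ι => A) i) (v i) + z * g (0, 1) := by
      have h1 : ((v, z) : (ι → A) × ℂ) = (∑ i, Pi.single i (v i), 0) + z • (0, 1) := by
        rw [Finset.univ_sum_single]
        simp
      have h2 : ((∑ i, Pi.single i (v i), 0) : (ι → A) × ℂ) =
          ContinuousLinearMap.inl ℂ (ι → A) ℂ (∑ i, Pi.single i (v i)) := rfl
      rw [h1, map_add, map_smul, smul_eq_mul, h2, map_sum, map_sum]
      rfl
    have hc' (i : ι) : bidualOp (NormedSpace.inclusionInDoubleDual ℂ A (c i)) ∈ X := by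
      rw [bidualOp_inclusion]
      exact hc i
    have ht : Tendsto (fun j => g (P (α j))) atTop (𝓝 (g (c, y f))) := by
      rw [hdec c, show (fun j => g (P (α j))) = _ from funext fun j => hdec _ _]
      refine (tendsto_finsetSum _ fun i _ => ?_).add
        ((tendsto_of_tendsto_vectorFunctional hlim y hy f).mul_const _)
      have := tendsto_of_tendsto_vectorFunctional hlim _ (hc' i)
        (g ∘L ContinuousLinearMap.inl ℂ (ι → A) ℂ ∘L
          ContinuousLinearMap.single ℂ (fun _ : ι => A) i)
      simp only [bidualOp_inclusion] at this
      exact this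
    have hle : RCLike.re (g (c, y f)) ≤ u :=
      le_of_tendsto ((RCLike.continuous_re.tendsto _).comp ht)
        (Eventually.of_forall fun j => (hg _ (subset_closure ⟨α j, hα j, rfl⟩)).le)
    exact absurd hu hle.not_gt
  obtain ⟨_, ⟨α, hα, rfl⟩, hd⟩ := Metric.mem_closure_iff.mp hmem ε hε
  rw [dist_comm, Prod.dist_eq, max_lt_iff, dist_pi_lt_iff hε] at hd
  refine ⟨α, hα, fun i => ?_, ?_⟩
  · rw [← dist_eq_norm]
    exact hd.1 i
  · rw [← dist_eq_norm]
    exact hd.2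

end Approximation

theorem CStarMatrix.isSelfAdjoint_sum_star_mul_mul {B n : Type*} [Fintype n] [NonUnitalRing B]
    [StarRing B] {M : CStarMatrix n n B} (hM : IsSelfAdjoint M) (v : n → B) :
    IsSelfAdjoint (∑ p, ∑ q, star (v p) * M p q * v q) := by
  rw [isSelfAdjoint_iff, star_sum]
  simp only [star_sum, star_mul, star_star]
  rw [Finset.sum_comm]
  refine Finset.sum_congr rfl fun p _ => Finset.sum_congr rfl fun q _ => ?_
  rw [CStarMatrix.star_apply_of_isSelfAdjoint hM, mul_assoc]

/-! ### Duality between completely positive maps and matrices over an operator system -/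

section Entries

/-- The matrix entry as a linear functional. -/
def entryLin {k : ℕ} (i j : Fin k) : Mat k →ₗ[ℂ] ℂ where
  toFun x := x i j
  map_add' _ _ := rfl
  map_smul' _ _ := rfl

theorem entryLin_apply {k : ℕ} (i j : Fin k) (x : Mat k) : entryLin i j x = x i j := rfl

instance finiteDimensional_mat (k : ℕ) : FiniteDimensional ℂ (Mat k) :=
  inferInstanceAs (FiniteDimensional ℂ (Matrix (Fin k) (Fin k) ℂ))

/-- Compress by the matrices v i all of whose columns are the basis vector eᵢ: every entry of (v i)⋆
N i j (v j) equals N i j i j. This is the pairing that turns a completely positive map into a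
positive functional on matrices. -/
theorem sum_entry_nonneg {k : ℕ} {N : CStarMatrix (Fin k) (Fin k) (Mat k)} (hN : 0 ≤ N) :
    0 ≤ ∑ i, ∑ j, N i j i j := by
  rcases k with _ | k
  · simp
  let v (i : Fin (k + 1)) : Mat (k + 1) := CStarMatrix.ofMatrix fun s _ => if s = i then 1 else 0
  have hv (i s p) : v i s p = if s = i then 1 else 0 := rfl
  have h := CStarMatrix.diag_nonneg (CStarMatrix.sum_star_mul_mul_nonneg hN v) 0
  change 0 ≤ entryLin 0 0 (∑ i, ∑ j, star (v i) * N i j * v j) at h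
  rw [map_sum] at h
  convert h using 2 with i
  rw [map_sum]
  refine Finset.sum_congr rfl fun j _ => ?_
  rw [entryLin_apply, CStarMatrix.mul_apply, Finset.sum_eq_single j, CStarMatrix.mul_apply,
    Finset.sum_eq_single i]
  · rw [CStarMatrix.star_apply, hv, hv]
    simp
  · intro s _ hs
    rw [CStarMatrix.star_apply, hv, if_neg hs]
    simp
  · simp
  · intro s _ hs
    rw [hv, if_neg hs, mul_zero]
  · simp

variable {A : Type u} [CStarAlgebra A] [PartialOrder A] [StarOrderedRing A]

/-- The matrix entry of a completely positive map, as a bounded functional. -/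
def entryFunctional {k : ℕ} (φ : A →CP Mat k) (i j : Fin k) : StrongDual ℂ A where
  toLinearMap := entryLin i j ∘ₗ φ.toLinearMap
  cont := (LinearMap.continuous_of_finiteDimensional (entryLin i j)).comp (map_continuous φ)

theorem trComp_eq_sum_entryFunctional {k : ℕ} (φ : A →CP Mat k) :
    trComp φ = (k : ℂ)⁻¹ • ∑ i, entryFunctional φ i i := by
  ext a
  rw [smul_apply, sum_apply]
  rfl

end Entries

section PositiveMap

variable {R S : Type*} [CStarAlgebra R] [PartialOrder R] [StarOrderedRing R]
  [CStarAlgebra S] [PartialOrder S] [StarOrderedRing S] {X : Submodule ℂ R} {α : X →ₗ[ℂ] S}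

/-- X contains no positive parts in general, but x = (‖x‖ + x) - ‖x‖ is a difference of positive
elements of X. -/
theorem isSelfAdjoint_map_of_map_nonneg (h1 : (1 : R) ∈ X)
    (hα : ∀ x : X, 0 ≤ (x : R) → 0 ≤ α x) (x : X) (hx : IsSelfAdjoint (x : R)) :
    IsSelfAdjoint (α x) := by
  let r : X := (‖(x : R)‖ : ℂ) • ⟨1, h1⟩
  have hr : (r : R) = algebraMap ℝ R ‖(x : R)‖ := by
    rw [Algebra.algebraMap_eq_smul_one]
    exact Complex.coe_smul _ _
  have h1 : 0 ≤ α r := hα r (hr ▸ algebraMap_nonneg R (norm_nonneg _))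
  have h2 : 0 ≤ α (r + x) := hα _ (by
    have := hx.neg_algebraMap_norm_le_self
    rw [neg_le_iff_add_nonneg', ← hr] at this
    exact this)
  have h3 : α x = α (r + x) - α r := by rw [map_add, add_sub_cancel_left]
  rw [h3]
  exact (IsSelfAdjoint.of_nonneg h2).sub (IsSelfAdjoint.of_nonneg h1)

theorem map_star_of_map_nonneg (h1 : (1 : R) ∈ X) (hstar : ∀ x ∈ X, star x ∈ X)
    (hα : ∀ x : X, 0 ≤ (x : R) → 0 ≤ α x) (x : X) :
    α ⟨star (x : R), hstar x x.2⟩ = star (α x) := by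
  set x' : X := ⟨star (x : R), hstar x x.2⟩ with hx'
  have hs : star (α (x + x')) = α (x + x') :=
    isSelfAdjoint_map_of_map_nonneg h1 hα _ (IsSelfAdjoint.add_star_self (x : R))
  have ht : star (α (Complex.I • (x - x'))) = α (Complex.I • (x - x')) := by
    refine isSelfAdjoint_map_of_map_nonneg h1 hα _ ?_
    change star (Complex.I • ((x : R) - star (x : R))) = Complex.I • ((x : R) - star (x : R))
    rw [star_smul, star_sub, star_star, Complex.star_def, Complex.conj_I, neg_smul, ← smul_neg,
      neg_sub]
  rw [map_add, star_add] at hs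
  rw [map_smul, star_smul, Complex.star_def, Complex.conj_I, neg_smul, ← smul_neg,
    (smul_right_injective S Complex.I_ne_zero).eq_iff, map_sub, star_sub, neg_sub] at ht
  have h2 : (2 : ℂ) • α x' = (2 : ℂ) • star (α x) := by
    rw [two_smul, two_smul]
    calc α x' + α x' = (α x + α x') - (α x - α x') := by abel
      _ = star (α x) + star (α x) := by rw [← hs, ← ht]; abel
  exact smul_right_injective S two_ne_zero h2

end PositiveMap

section OperatorSystem

variable {A : Type u} [CStarAlgebra A] [PartialOrder A] [StarOrderedRing A]
  {X : Submodule ℂ (UniversalSpace A →L[ℂ] UniversalSpace A)} {α : X →ₗ[ℂ] A}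

theorem IsContractiveCP.map_nonneg (hα : IsContractiveCP α) (x : X)
    (hx : 0 ≤ (x : UniversalSpace A →L[ℂ] UniversalSpace A)) : 0 ≤ α x := by
  have h : 0 ≤ CStarMatrix.ofMatrix ((Matrix.of fun _ _ : Fin 1 => x).map
      (Subtype.val : X → (UniversalSpace A →L[ℂ] UniversalSpace A))) := by
    refine CStarMatrix.nonneg_of_sum_star_mul_mul_nonneg ?_ fun v => ?_
    · ext1 i j
      rw [CStarMatrix.star_apply]
      exact (IsSelfAdjoint.of_nonneg hx).star_eq
    · simp only [Fin.sum_univ_one]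
      exact star_left_conjugate_nonneg hx (v 0)
  exact CStarMatrix.diag_nonneg (hα.map_cstarMatrix_nonneg 1 _ h) 0

theorem IsContractiveCP.map_star (hX : IsFinDimOperatorSystem A X)
    (hα : IsContractiveCP α) (x : X) :
    α ⟨star (x : UniversalSpace A →L[ℂ] UniversalSpace A), hX.star_mem x x.2⟩ = star (α x) :=
  map_star_of_map_nonneg (R := UniversalSpace A →L[ℂ] UniversalSpace A) (S := A) (X := X) (α := α)
    hX.one_mem hX.star_mem hα.map_nonneg x

end OperatorSystem

section OperatorMatrix

variable {H : Type*} [NormedAddCommGroup H] [InnerProductSpace ℂ H] [CompleteSpace H]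

/-- A matrix `T + T⋆` of operators is positive if the real part of the quadratic form of `T` is. -/
theorem operatorMatrix_add_star_nonneg {k : ℕ} (T : Fin k → Fin k → (H →L[ℂ] H))
    (hT : ∀ ξ : Fin k → H, 0 ≤ (∑ i, ∑ j, ⟪ξ i, T i j (ξ j)⟫_ℂ).re) :
    0 ≤ CStarMatrix.ofMatrix (Matrix.of fun i j => T i j + star (T j i)) := by
  set M : CStarMatrix (Fin k) (Fin k) (H →L[ℂ] H) :=
    CStarMatrix.ofMatrix (Matrix.of fun i j => T i j + star (T j i)) with hM
  have hMij (i j) : M i j = T i j + star (T j i) := rfl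
  have hs : IsSelfAdjoint M := by
    refine CStarMatrix.ext fun i j => ?_
    rw [CStarMatrix.star_apply, hMij, hMij, star_add, star_star, add_comm]
  refine CStarMatrix.nonneg_of_sum_star_mul_mul_nonneg hs fun v => ?_
  rw [ContinuousLinearMap.nonneg_iff_isPositive]
  rw [ContinuousLinearMap.isPositive_def']
  refine ⟨CStarMatrix.isSelfAdjoint_sum_star_mul_mul hs v, fun h => ?_⟩
  have hin : ⟪h, (∑ i, ∑ j, star (v i) * M i j * v j) h⟫_ℂ =
      ∑ i, ∑ j, ⟪v i h, T i j (v j h)⟫_ℂ +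
        starRingEnd ℂ (∑ i, ∑ j, ⟪v i h, T i j (v j h)⟫_ℂ) := by
    have h1 (i j) : ⟪h, (star (v i) * M i j * v j) h⟫_ℂ =
        ⟪v i h, T i j (v j h)⟫_ℂ + starRingEnd ℂ ⟪v j h, T j i (v i h)⟫_ℂ := by
      rw [mul_apply_eq_comp, mul_apply_eq_comp, ContinuousLinearMap.star_eq_adjoint,
        ContinuousLinearMap.adjoint_inner_right, hMij, add_apply, inner_add_right,
        ContinuousLinearMap.star_eq_adjoint, ContinuousLinearMap.adjoint_inner_right,
        inner_conj_symm]
    simp only [sum_apply, inner_sum, h1, Finset.sum_add_distrib, map_sum]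
    congr 1
    exact Finset.sum_comm
  rw [ContinuousLinearMap.reApplyInnerSelf_apply, ← inner_conj_symm, hin]
  have := hT fun i => v i h
  change 0 ≤ (starRingEnd ℂ (_ + starRingEnd ℂ _)).re
  rw [Complex.conj_re, Complex.add_re, Complex.conj_re]
  exact add_nonneg this this

end OperatorMatrix

section Duality

variable {A : Type u} [CStarAlgebra A] [PartialOrder A] [StarOrderedRing A]
  {X : Submodule ℂ (UniversalSpace A →L[ℂ] UniversalSpace A)} {α : X →ₗ[ℂ] A}

/-- The value at `y` of the weak-⋆ continuous extension of `ψ` to the bidual. -/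
def normalExtension {k : ℕ} (ψ : A →CP Mat k) (y : StrongDual ℂ (StrongDual ℂ A)) : Mat k :=
  CStarMatrix.ofMatrix (Matrix.of fun i j => y (entryFunctional ψ i j))

theorem tr_normalExtension {k : ℕ} (ψ : A →CP Mat k) (y : StrongDual ℂ (StrongDual ℂ A)) :
    tr k (normalExtension ψ y) = y (trComp ψ) := by
  rw [trComp_eq_sum_entryFunctional, map_smul, map_sum]
  rfl

theorem entryFunctional_cpAdd {k : ℕ} (ψ ψ' : A →CP Mat k) (i j : Fin k) :
    entryFunctional (cpAdd ψ ψ') i j = entryFunctional ψ i j + entryFunctional ψ' i j := rfl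

theorem entryFunctional_cpSMul {k : ℕ} (c : ℝ) (hc : 0 ≤ c) (ψ : A →CP Mat k) (i j : Fin k) :
    entryFunctional (cpSMul c hc ψ) i j = (c : ℂ) • entryFunctional ψ i j := rfl

/-- The symmetrized matrix with entries T i j + (T j i)⋆ is positive over B(H). Its image under α
and φ is positive, and its entry sum is twice the real part in question. -/
theorem re_sum_entry_nonneg (hX : IsFinDimOperatorSystem A X) (hα : IsContractiveCP α) {k : ℕ}
    (φ : A →CP Mat k) (T : Fin k → Fin k → X)
    (hT : ∀ ξ : Fin k → UniversalSpace A, 0 ≤ (∑ i, ∑ j,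
      ⟪ξ i, (T i j : UniversalSpace A →L[ℂ] UniversalSpace A) (ξ j)⟫_ℂ).re) :
    0 ≤ (∑ i, ∑ j, φ (α (T i j)) i j).re := by
  let T' : Matrix (Fin k) (Fin k) X := Matrix.of fun i j =>
    T i j + ⟨star (T j i : UniversalSpace A →L[ℂ] UniversalSpace A), hX.star_mem _ (T j i).2⟩
  have h1 : 0 ≤ CStarMatrix.ofMatrix (T'.map
      (Subtype.val : X → (UniversalSpace A →L[ℂ] UniversalSpace A))) :=
    operatorMatrix_add_star_nonneg (fun i j => (T i j : UniversalSpace A →L[ℂ] UniversalSpace A)) hT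
  have h2 := sum_entry_nonneg
    (φ.map_cstarMatrix_nonneg' k _ (hα.map_cstarMatrix_nonneg k T' h1))
  have h3 (i j : Fin k) : φ (α (T' i j)) i j =
      φ (α (T i j)) i j + starRingEnd ℂ (φ (α (T j i)) j i) := by
    have e : α (T' i j) = α (T i j) + star (α (T j i)) :=
      (map_add α _ _).trans (congrArg (α (T i j) + ·) (hα.map_star hX (T j i)))
    rw [e, map_add, cp_map_star]
    rfl
  have h4 : ∑ i, ∑ j, φ (α (T' i j)) i j = ∑ i, ∑ j, φ (α (T i j)) i j +
      starRingEnd ℂ (∑ i, ∑ j, φ (α (T i j)) i j) := by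
    simp only [h3, Finset.sum_add_distrib, map_sum]
    congr 1
    exact Finset.sum_comm
  have h5 : 0 ≤ ∑ i, ∑ j, φ (α (T' i j)) i j := h2
  rw [h4] at h5
  have := (Complex.le_def.mp h5).1
  simp only [Complex.add_re, Complex.conj_re, Complex.zero_re] at this
  linarith

/-- The composition of completely positive maps `X → A → M_k` on an operator system `X ⊆ A**` is
approximated pointwise by the normal extensions of completely positive maps `A → M_k`. -/
theorem exists_cp_approx (hX : IsFinDimOperatorSystem A X) (hα : IsContractiveCP α) {k : ℕ}
    (φ : A →CP Mat k) {ι : Type*} [Fintype ι] (y : ι → StrongDual ℂ (StrongDual ℂ A))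
    (hy : ∀ l, bidualOp (y l) ∈ X) :
    (fun l => φ (α ⟨bidualOp (y l), hy l⟩)) ∈
      closure (Set.range fun (ψ : A →CP Mat k) l => normalExtension ψ (y l)) := by
  classical
  let P (ψ : A →CP Mat k) : ι × Fin k × Fin k → ℂ :=
    fun p => y p.1 (entryFunctional ψ p.2.1 p.2.2)
  have hPadd (ψ ψ') : P (cpAdd ψ ψ') = P ψ + P ψ' :=
    funext fun p => (congrArg (y p.1) (entryFunctional_cpAdd ψ ψ' p.2.1 p.2.2)).trans
      (map_add (y p.1) _ _)
  have hPsmul (c : ℝ) (hc : 0 ≤ c) (ψ) : P (cpSMul c hc ψ) = (c : ℂ) • P ψ :=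
    funext fun p => (congrArg (y p.1) (entryFunctional_cpSMul c hc ψ p.2.1 p.2.2)).trans
      (map_smul (y p.1) (c : ℂ) _)
  have hsmul (r : ℝ) (v : ι × Fin k × Fin k → ℂ) : (r : ℂ) • v = r • v :=
    funext fun i => Complex.coe_smul r (v i)
  let t : ι × Fin k × Fin k → ℂ := fun p => φ (α ⟨bidualOp (y p.1), hy p.1⟩) p.2.1 p.2.2
  have hconv : Convex ℝ (Set.range P) := by
    rintro _ ⟨ψ, rfl⟩ _ ⟨ψ', rfl⟩ a b ha hb hab
    refine ⟨cpAdd (cpSMul a ha ψ) (cpSMul b hb ψ'), ?_⟩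
    rw [hPadd, hPsmul, hPsmul, hsmul, hsmul]
  have hmem : t ∈ closure (Set.range P) := by
    by_contra hnot
    obtain ⟨g, u, hu, hg⟩ := RCLike.geometric_hahn_banach_point_closed (𝕜 := ℂ) hconv.closure
      isClosed_closure hnot
    -- The image of P contains 0.
    have hu0 : u < 0 := by
      have := hg _ (subset_closure ⟨cpSMul 0 le_rfl (cpZero : A →CP Mat k), rfl⟩)
      rw [hPsmul] at this
      simpa using this
    -- The image of P is a cone, so a functional bounded below on it is nonnegative: otherwise
    -- rescaling ψ reaches the value u exactly.
    have hg0 (ψ : A →CP Mat k) : 0 ≤ (g (P ψ)).re := by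
      by_contra! hneg
      have hc : 0 ≤ u / (g (P ψ)).re := (div_pos_of_neg_of_neg hu0 hneg).le
      have := hg _ (subset_closure ⟨cpSMul _ hc ψ, rfl⟩)
      rw [hPsmul, map_smul, smul_eq_mul] at this
      have h2 : RCLike.re ((((u / (g (P ψ)).re : ℝ)) : ℂ) * g (P ψ)) = u := by
        change ((((u / (g (P ψ)).re : ℝ)) : ℂ) * g (P ψ)).re = u
        rw [Complex.re_ofReal_mul, div_mul_cancel₀ _ hneg.ne]
      rw [h2] at this
      exact lt_irrefl _ this
    have hdec (v : ι × Fin k × Fin k → ℂ) :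
        g v = ∑ i, ∑ j, ∑ l, v (l, i, j) * g (Pi.single (l, i, j) 1) := by
      conv_lhs => rw [pi_eq_sum_univ' v, map_sum]
      rw [Fintype.sum_prod_type, Finset.sum_comm, Fintype.sum_prod_type]
      simp only [map_smul, smul_eq_mul]
    -- The coefficients of the separating functional g, assembled into a matrix over X. Pairing with
    -- vector maps of A gives the quadratic form of T, which is therefore nonnegative in real part;
    -- pairing with φ ∘ α gives g(t), whose real part is negative.
    let T (i j : Fin k) : X := ∑ l, g (Pi.single (l, i, j) 1) • ⟨bidualOp (y l), hy l⟩
    have hT := re_sum_entry_nonneg hX hα φ T fun ξ => by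
      refine (hg0 (vectorCP (universalRep A) ξ)).trans_eq ?_
      rw [hdec]
      congr 1
      refine Finset.sum_congr rfl fun i _ => Finset.sum_congr rfl fun j _ => ?_
      have e : (T i j : UniversalSpace A →L[ℂ] UniversalSpace A) =
          ∑ l, g (Pi.single (l, i, j) 1) • bidualOp (y l) := by
        simp only [T, Submodule.coe_sum, Submodule.coe_smul]
      rw [e, sum_apply, inner_sum]
      refine Finset.sum_congr rfl fun l _ => ?_
      rw [smul_apply, inner_smul_right, inner_bidualOp, mul_comm]
      rfl
    have ht : ∑ i, ∑ j, φ (α (T i j)) i j = g t := by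
      rw [hdec]
      refine Finset.sum_congr rfl fun i _ => Finset.sum_congr rfl fun j _ => ?_
      change entryLin i j (φ (α (∑ l, g (Pi.single (l, i, j) 1) • ⟨bidualOp (y l), hy l⟩))) = _
      rw [map_sum, map_sum, map_sum]
      refine Finset.sum_congr rfl fun l _ => ?_
      rw [map_smul, map_smul, map_smul, smul_eq_mul, mul_comm]
      rfl
    rw [ht] at hT
    exact absurd (hu.trans hu0) hT.not_gt
  let Φ (v : ι × Fin k × Fin k → ℂ) : ι → Mat k :=
    fun l => CStarMatrix.ofMatrix (Matrix.of fun i j => v (l, i, j))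
  have hΦ : Continuous Φ := by
    refine continuous_pi fun l => ?_
    have h : Continuous fun v : ι × Fin k × Fin k → ℂ =>
        (Matrix.of fun i j => v (l, i, j) : Matrix (Fin k) (Fin k) ℂ) :=
      continuous_matrix fun i j => continuous_apply _
    exact h
  refine map_mem_closure hΦ hmem ?_
  rintro _ ⟨ψ, rfl⟩
  exact ⟨ψ, rfl⟩

end Duality

/-! ### Finitely generated operator systems -/

theorem exists_starClosed_submodule {R : Type*} [CStarAlgebra R] (M : StarSubalgebra ℂ R)
    (S : Set R) (hS : S.Finite) (hSM : ∀ x ∈ S, x ∈ M) :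
    ∃ X : Submodule ℂ R, (∀ x ∈ X, x ∈ M) ∧ 1 ∈ X ∧ (∀ x ∈ X, star x ∈ X) ∧
      FiniteDimensional ℂ X ∧ ∀ x ∈ S, x ∈ X := by
  let S' : Set R := {1} ∪ (S ∪ star S)
  have hstar : star S' = S' := by
    simp only [S', Set.union_star, star_star, Set.star_singleton, star_one]
    rw [Set.union_comm (star S)]
  have hfin : S'.Finite := (Set.finite_singleton _).union (hS.union hS.star)
  have hmem : ∀ x ∈ S', x ∈ M := by
    rintro x (rfl | hx | hx)
    · exact one_mem _
    · exact hSM x hx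
    · rw [← star_star x]
      exact star_mem (hSM _ hx)
  refine ⟨Submodule.span ℂ S', fun x hx => ?_, Submodule.subset_span (Or.inl rfl), fun x hx => ?_,
    FiniteDimensional.span_of_finite ℂ hfin, fun x hx => Submodule.subset_span (Or.inr (Or.inl hx))⟩
  · induction hx using Submodule.span_induction with
    | mem x hx => exact hmem x hx
    | zero => exact zero_mem _
    | add x y _ _ hx hy => exact add_mem hx hy
    | smul c x _ hx => exact SMulMemClass.smul_mem c hx
  · induction hx using Submodule.span_induction with
    | mem x hx =>
      refine Submodule.subset_span ?_
      rw [← hstar]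
      exact Set.star_mem_star.mpr hx
    | zero => rw [star_zero]; exact zero_mem _
    | add x y _ _ hx hy => rw [star_add]; exact add_mem hx hy
    | smul c x _ hx => rw [star_smul]; exact Submodule.smul_mem _ _ hx

section OperatorSystemSpan

variable {A : Type u} [CStarAlgebra A] [PartialOrder A] [StarOrderedRing A]

theorem exists_finDimOperatorSystem (S : Set (UniversalSpace A →L[ℂ] UniversalSpace A))
    (hS : S.Finite) (hSA : ∀ x ∈ S, x ∈ enveloping A) :
    ∃ X : Submodule ℂ (UniversalSpace A →L[ℂ] UniversalSpace A),
      IsFinDimOperatorSystem A X ∧ ∀ x ∈ S, x ∈ X := by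
  obtain ⟨X, h1, h2, h3, h4, h5⟩ := exists_starClosed_submodule
    (R := UniversalSpace A →L[ℂ] UniversalSpace A) (enveloping A).toStarSubalgebra S hS hSA
  exact ⟨X, ⟨h1, h2, h3, h4⟩, h5⟩

/-- Local reflexivity, in the form in which operator systems and maps out of them no longer appear:
elements `a i` of `A` and `y` of `A**` are replaced by elements `b i`, `z` of `A` at which the
completely positive maps to matrix algebras take values that are approximated by the values at
`a i` and `y` of (normal extensions of) completely positive maps. -/
theorem exists_approx_points (hA : IsLocallyReflexive A) {κ : Type*} [Fintype κ] (a : κ → A)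
    (y : StrongDual ℂ (StrongDual ℂ A)) (f : StrongDual ℂ A) {δ : ℝ} (hδ : 0 < δ) :
    ∃ (b : κ → A) (z : A), (∀ i, ‖b i - a i‖ < δ) ∧ ‖f z - y f‖ < δ ∧
      ∀ (k : ℕ) (φ : A →CP Mat k), ((fun i => φ (b i), φ z) : (κ → Mat k) × Mat k) ∈
        closure (Set.range fun ψ : A →CP Mat k =>
          ((fun i => ψ (a i), normalExtension ψ y) : (κ → Mat k) × Mat k)) := by
  let w (l : Option κ) : StrongDual ℂ (StrongDual ℂ A) :=
    l.elim y fun i => NormedSpace.inclusionInDoubleDual ℂ A (a i)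
  obtain ⟨X, hX, hSX⟩ := exists_finDimOperatorSystem (Set.range fun l => bidualOp (w l))
    (Set.finite_range _) (by rintro _ ⟨l, rfl⟩; exact bidualOp_mem_enveloping _)
  have hw (l) : bidualOp (w l) ∈ X := hSX _ ⟨l, rfl⟩
  have ha (i : κ) : universalRep A (a i) ∈ X := by
    rw [← bidualOp_inclusion]
    exact hw (some i)
  obtain ⟨α, hα, h1, h2⟩ := exists_contractiveCP_approx hA hX a ha y (hw none) f hδ
  refine ⟨fun i => α ⟨universalRep A (a i), ha i⟩, α ⟨bidualOp y, hw none⟩, h1, h2, fun k φ => ?_⟩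
  have h := exists_cp_approx hX hα φ w hw
  let Φ (v : Option κ → Mat k) : (κ → Mat k) × Mat k := (fun i => v (some i), v none)
  have hΦ : Continuous Φ :=
    (continuous_pi fun i => continuous_apply (some i)).prodMk (continuous_apply none)
  have h' := map_mem_closure hΦ h (t := Set.range fun ψ : A →CP Mat k =>
    ((fun i => ψ (a i), normalExtension ψ y) : (κ → Mat k) × Mat k)) (by
      rintro _ ⟨ψ, rfl⟩
      exact ⟨ψ, rfl⟩)
  have e : Φ (fun l => φ (α ⟨bidualOp (w l), hw l⟩)) =
      (fun i => φ (α ⟨universalRep A (a i), ha i⟩), φ (α ⟨bidualOp y, hw none⟩)) := by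
    refine Prod.ext (funext fun i => ?_) rfl
    exact congrArg (fun x => φ (α x)) (Subtype.ext (bidualOp_inclusion (a i)))
  rwa [e] at h'

end OperatorSystemSpan

/-! ### The normalized trace and the 2-norm -/

section Trace

theorem tr_apply {k : ℕ} (x : Mat k) : tr k x = (k : ℂ)⁻¹ * ∑ i, x i i := rfl

theorem continuous_tr (k : ℕ) : Continuous (tr k) :=
  LinearMap.continuous_of_finiteDimensional _

theorem tr_nonneg {k : ℕ} {x : Mat k} (hx : 0 ≤ x) : 0 ≤ tr k x :=
  mul_nonneg (inv_nonneg.mpr (Nat.cast_nonneg k))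
    (Finset.sum_nonneg fun i _ => CStarMatrix.diag_nonneg hx i)

theorem norm_tr_le {k : ℕ} (x : Mat k) : ‖tr k x‖ ≤ ‖x‖ := by
  rcases Nat.eq_zero_or_pos k with rfl | hk
  · simp [tr_apply]
  have hk' : (0 : ℝ) < k := Nat.cast_pos.mpr hk
  rw [tr_apply, norm_mul, norm_inv, Complex.norm_natCast, inv_mul_le_iff₀ hk']
  refine (norm_sum_le _ _).trans ?_
  refine (Finset.sum_le_card_nsmul _ _ ‖x‖ fun i _ => CStarMatrix.norm_entry_le_norm).trans_eq ?_
  simp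

/-- The normalized trace as a positive functional. -/
def trPos (k : ℕ) : Mat k →ₚ[ℂ] ℂ := PositiveLinearMap.mk₀ (tr k) fun _ hx => tr_nonneg hx

/-- The 2-norm is the GNS seminorm of the trace, which supplies its triangle inequality. -/
theorem twoNorm_eq_norm {k : ℕ} (x : Mat k) : twoNorm x = ‖(trPos k).toPreGNS x‖ := rfl

theorem twoNorm_nonneg {k : ℕ} (x : Mat k) : 0 ≤ twoNorm x := Real.sqrt_nonneg _

theorem twoNorm_add_le {k : ℕ} (x y : Mat k) : twoNorm (x + y) ≤ twoNorm x + twoNorm y := by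
  simp only [twoNorm_eq_norm, map_add]
  exact norm_add_le _ _

theorem twoNorm_le_norm {k : ℕ} (x : Mat k) : twoNorm x ≤ ‖x‖ := by
  refine Real.sqrt_le_iff.mpr ⟨norm_nonneg x, ?_⟩
  calc (tr k (star x * x)).re ≤ ‖tr k (star x * x)‖ := Complex.re_le_norm _
    _ ≤ ‖star x * x‖ := norm_tr_le _
    _ = ‖x‖ ^ 2 := (CStarRing.norm_star_mul_self (x := x)).trans (sq _).symm

theorem continuous_twoNorm (k : ℕ) : Continuous (twoNorm : Mat k → ℝ) :=
  (Complex.continuous_re.comp ((continuous_tr k).comp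
    (continuous_star.mul continuous_id))).sqrt

theorem twoNorm_sq {k : ℕ} (x : Mat k) : twoNorm x ^ 2 = (tr k (star x * x)).re :=
  Real.sq_sqrt (Complex.le_def.mp (tr_nonneg (star_mul_self_nonneg x))).1

end Trace

/-! ### Block diagonal sums of matrices and of completely positive maps -/

section BlockDiagonal

variable {ι : Type} [Fintype ι] (k : ι → ℕ)

/-- The size of a block diagonal matrix. -/
def blockSize : ℕ := Fintype.card (Σ i, Fin (k i))

theorem blockSize_eq_sum : blockSize k = ∑ i, k i := by
  simp [blockSize]

theorem blockSize_pos [Nonempty ι] (hk : ∀ i, 0 < k i) : 0 < blockSize k := by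
  rw [blockSize_eq_sum]
  exact Finset.sum_pos (fun i _ => hk i) Finset.univ_nonempty

variable [DecidableEq ι]

/-- The block diagonal embedding as a star homomorphism. -/
def blockDiag : (∀ i, Mat (k i)) →⋆ₙₐ[ℂ] Mat (blockSize k) where
  toFun x := CStarMatrix.ofMatrix
    ((Matrix.blockDiagonal' fun i => CStarMatrix.ofMatrix.symm (x i)).submatrix
      (Fintype.equivFin _).symm (Fintype.equivFin _).symm)
  map_smul' c x := by
    refine congrArg (fun m => Matrix.submatrix m (Fintype.equivFin _).symm (Fintype.equivFin _).symm)
      (Matrix.blockDiagonal'_smul c fun i => CStarMatrix.ofMatrix.symm (x i))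
  map_zero' := by
    refine congrArg (fun m => Matrix.submatrix m (Fintype.equivFin _).symm (Fintype.equivFin _).symm)
      (Matrix.blockDiagonal'_zero)
  map_add' x y := by
    refine congrArg (fun m => Matrix.submatrix m (Fintype.equivFin _).symm (Fintype.equivFin _).symm)
      (Matrix.blockDiagonal'_add (fun i => CStarMatrix.ofMatrix.symm (x i)) _)
  map_mul' x y := by
    refine (congrArg (fun m => Matrix.submatrix m (Fintype.equivFin _).symm
      (Fintype.equivFin _).symm) (Matrix.blockDiagonal'_mul
        (fun i => CStarMatrix.ofMatrix.symm (x i)) fun i => CStarMatrix.ofMatrix.symm (y i))).trans ?_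
    exact (Matrix.submatrix_mul_equiv
      (Matrix.blockDiagonal' fun i => CStarMatrix.ofMatrix.symm (x i))
      (Matrix.blockDiagonal' fun i => CStarMatrix.ofMatrix.symm (y i))
      (Fintype.equivFin _).symm (Fintype.equivFin _).symm (Fintype.equivFin _).symm).symm
  map_star' x := by
    refine congrArg (fun m => Matrix.submatrix m (Fintype.equivFin _).symm (Fintype.equivFin _).symm)
      (Matrix.blockDiagonal'_conjTranspose fun i => CStarMatrix.ofMatrix.symm (x i)).symm

theorem blockDiag_one : blockDiag k 1 = 1 := by
  have h := congrArg (fun m => Matrix.submatrix m (Fintype.equivFin (Σ i, Fin (k i))).symm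
    (Fintype.equivFin (Σ i, Fin (k i))).symm)
    (Matrix.blockDiagonal'_one (α := ℂ) (m' := fun i => Fin (k i)))
  exact h.trans (Matrix.submatrix_one_equiv _)

theorem sum_diag_blockDiag (x : ∀ i, Mat (k i)) :
    ∑ s, blockDiag k x s s = ∑ i, ∑ s, x i s s := by
  refine (Equiv.sum_comp (Fintype.equivFin (Σ i, Fin (k i)))
    fun s => blockDiag k x s s).symm.trans ?_
  rw [Fintype.sum_sigma]
  refine Finset.sum_congr rfl fun i _ => Finset.sum_congr rfl fun s _ => ?_
  have h (M : ∀ i, Matrix (Fin (k i)) (Fin (k i)) ℂ) (p q : Σ i, Fin (k i)) (hp : p = ⟨i, s⟩)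
      (hq : q = ⟨i, s⟩) : Matrix.blockDiagonal' M p q = M i s s := by
    rw [hp, hq, Matrix.blockDiagonal'_apply_eq]
  exact h x _ _ (Equiv.symm_apply_apply _ _) (Equiv.symm_apply_apply _ _)

theorem tr_blockDiag (hk : ∀ i, 0 < k i) (x : ∀ i, Mat (k i)) :
    tr _ (blockDiag k x) = (blockSize k : ℂ)⁻¹ * ∑ i, (k i : ℂ) * tr (k i) (x i) := by
  rw [tr_apply, sum_diag_blockDiag]
  congr 1
  refine Finset.sum_congr rfl fun i _ => ?_
  rw [tr_apply, mul_inv_cancel_left₀ (Nat.cast_ne_zero.mpr (hk i).ne')]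

theorem norm_blockDiag_le (x : ∀ i, Mat (k i)) : ‖blockDiag k x‖ ≤ ‖x‖ :=
  NonUnitalStarAlgHom.norm_apply_le (blockDiag k) x

/-- The squared 2-norm of a block sum is the average of the squared 2-norms of the blocks, weighted
by their sizes. -/
theorem twoNorm_blockDiag_lt [Nonempty ι] (hk : ∀ i, 0 < k i) (x : ∀ i, Mat (k i)) {ε : ℝ}
    (hε : 0 < ε) (hx : ∀ i, twoNorm (x i) < ε) : twoNorm (blockDiag k x) < ε := by
  have hK : (0 : ℝ) < blockSize k := Nat.cast_pos.mpr (blockSize_pos k hk)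
  rw [← sq_lt_sq₀ (twoNorm_nonneg _) hε.le, twoNorm_sq, ← map_star, ← map_mul, tr_blockDiag k hk]
  have e : ((blockSize k : ℂ)⁻¹ * ∑ i, (k i : ℂ) * tr (k i) ((star x * x) i)).re =
      (blockSize k : ℝ)⁻¹ * ∑ i, (k i : ℝ) * twoNorm (x i) ^ 2 := by
    have e1 : ((blockSize k : ℂ)⁻¹) = (((blockSize k : ℝ)⁻¹ : ℝ) : ℂ) := by push_cast; rfl
    rw [e1, Complex.re_ofReal_mul, Complex.re_sum]
    congr 1
    refine Finset.sum_congr rfl fun i _ => ?_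
    rw [twoNorm_sq, ← Complex.ofReal_natCast, Complex.re_ofReal_mul]
    rfl
  rw [e, inv_mul_lt_iff₀ hK, blockSize_eq_sum, Nat.cast_sum, Finset.sum_mul]
  refine Finset.sum_lt_sum_of_nonempty Finset.univ_nonempty fun i _ => ?_
  have := hx i
  have hki : (0 : ℝ) < k i := Nat.cast_pos.mpr (hk i)
  gcongr
  exact twoNorm_nonneg _

variable {A : Type u} [CStarAlgebra A] [PartialOrder A] [StarOrderedRing A]

/-- The embedding of one diagonal block. -/
def blockSingle (i : ι) : Mat (k i) →⋆ₙₐ[ℂ] Mat (blockSize k) where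
  toFun x := blockDiag k (Pi.single i x)
  map_smul' c x := by rw [Pi.single_smul, map_smul]; rfl
  map_zero' := by rw [Pi.single_zero, map_zero]
  map_add' x y := by rw [Pi.single_add, map_add]
  map_mul' x y := by rw [Pi.single_mul, map_mul]
  map_star' x := by rw [← map_star, Pi.single_star]

variable {k} in
/-- The direct sum of completely positive maps into matrix algebras. -/
def blockCP (ψ : ∀ i, A →CP Mat (k i)) : A →CP Mat (blockSize k) :=
  cpSum Finset.univ fun i =>
    cpComp (CompletelyPositiveMapClass.toCompletelyPositiveLinearMap (blockSingle k i)) (ψ i)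

variable {k} in
theorem blockCP_apply (ψ : ∀ i, A →CP Mat (k i)) (a : A) :
    blockCP ψ a = blockDiag k fun i => ψ i a := by
  rw [blockCP, cpSum_apply]
  conv_rhs => rw [← Finset.univ_sum_single fun i => ψ i a, map_sum]
  rfl

end BlockDiagonal

/-- The properties of the operator norm and of the 2-norm of matrices that are used below. -/
structure IsMatrixNorm (N : ∀ k, Mat k → ℝ) : Prop where
  continuous : ∀ k, Continuous (N k)
  nonneg : ∀ k x, 0 ≤ N k x
  add_le : ∀ k x y, N k (x + y) ≤ N k x + N k y
  le_norm : ∀ k x, N k x ≤ ‖x‖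
  blockDiag_lt : ∀ {ι : Type} [Fintype ι] [DecidableEq ι] [Nonempty ι] (k : ι → ℕ),
    (∀ i, 0 < k i) → ∀ (x : ∀ i, Mat (k i)) {ε : ℝ}, 0 < ε → (∀ i, N (k i) (x i) < ε) →
      N _ (blockDiag k x) < ε

theorem isMatrixNorm_norm : IsMatrixNorm fun _ x => ‖x‖ where
  continuous _ := continuous_norm
  nonneg _ := norm_nonneg
  add_le _ := norm_add_le
  le_norm _ _ := le_rfl
  blockDiag_lt k _ x _ hε hx := (norm_blockDiag_le k x).trans_lt ((pi_norm_lt_iff hε).mpr hx)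

theorem isMatrixNorm_twoNorm : IsMatrixNorm fun _ x => twoNorm x where
  continuous := continuous_twoNorm
  nonneg _ := twoNorm_nonneg
  add_le _ := twoNorm_add_le
  le_norm _ := twoNorm_le_norm
  blockDiag_lt k hk x _ := twoNorm_blockDiag_lt k hk x

variable {A : Type u} [CStarAlgebra A] [PartialOrder A] [StarOrderedRing A]

/-! ### Correcting almost unital maps -/

section Unitalization

/-- With τ the vector state of ξ and b = c⋆c, the map τ(·)b is the sum over the rows q of c of the
vector maps at the families (c q i • ξ)ᵢ. -/
theorem exists_cp_smul {τ : StrongDual ℂ A} (hτ : ∀ a : A, 0 ≤ a → 0 ≤ τ a) (h1 : τ 1 = 1)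
    {k : ℕ} {b : Mat k} (hb : 0 ≤ b) : ∃ χ : A →CP Mat k, ∀ a, χ a = τ a • b := by
  obtain ⟨ξ, hξ⟩ := exists_vectorFunctional_eq_of_state
    (⟨PositiveLinearMap.mk₀ τ.toLinearMap hτ, h1⟩ : State A)
  have hξ' (a : A) : ⟪ξ, universalRep A a ξ⟫_ℂ = τ a := hξ a
  obtain ⟨c, rfl⟩ := exists_eq_star_mul_self_of_nonneg hb
  refine ⟨cpSum Finset.univ fun q => vectorCP (universalRep A) fun i => c q i • ξ, fun a => ?_⟩
  refine CStarMatrix.ext fun i j => ?_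
  rw [cpSum_apply, CStarMatrix.smul_apply, CStarMatrix.mul_apply]
  refine (map_sum (entryLin i j)
    (fun q => vectorCP (universalRep A) (fun i => c q i • ξ) a) Finset.univ).trans ?_
  rw [smul_eq_mul, Finset.mul_sum]
  refine Finset.sum_congr rfl fun q _ => ?_
  rw [entryLin_apply, vectorCP_apply, map_smul, inner_smul_left, inner_smul_right, hξ',
    CStarMatrix.star_apply, RCLike.star_def]
  ring

theorem norm_apply_le_of_nonneg {τ : StrongDual ℂ A} (hτ : ∀ a : A, 0 ≤ a → 0 ≤ τ a)
    (h1 : τ 1 = 1) (a : A) : ‖τ a‖ ≤ 2 * ‖a‖ := by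
  have := norm_le_of_map_nonneg τ.toLinearMap hτ a
  change ‖τ a‖ ≤ 2 * ‖τ 1‖ * ‖a‖ at this
  rwa [h1, norm_one, mul_one] at this

/-- An almost unital completely positive map is close to a unital one. -/
theorem exists_unital_near {τ : StrongDual ℂ A} (hτ : ∀ a : A, 0 ≤ a → 0 ≤ τ a) (h1 : τ 1 = 1)
    {k : ℕ} (hk : 0 < k) (ψ : A →CP Mat k) {δ : ℝ} (hδ1 : δ ≤ 1)
    (hψ : ‖ψ 1 - 1‖ ≤ δ) :
    ∃ ψ' : A →CP Mat k, ψ' 1 = 1 ∧ (∀ a, ‖ψ' a - ψ a‖ ≤ 8 * δ * ‖a‖) ∧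
      ∀ y : StrongDual ℂ (StrongDual ℂ A),
        ‖y (trComp ψ') - y (trComp ψ)‖ ≤ δ * ‖y (trComp ψ)‖ + 2 * δ * ‖y τ‖ := by
  have hδ0 : 0 ≤ δ := (norm_nonneg _).trans hψ
  have : Nonempty (Fin k) := ⟨⟨0, hk⟩⟩
  have hone : ‖(1 : Mat k)‖ = 1 := norm_one
  have hr0 : (0 : ℝ) < 1 + δ := by linarith
  -- This scaling makes rψ(1) ≤ 1, so the defect b = 1 - rψ(1) is positive and can be filled by
  -- τ(·)b.
  set r : ℝ := (1 + δ)⁻¹ with hr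
  have hrpos : 0 < r := inv_pos.mpr hr0
  have hr1 : r ≤ 1 := inv_le_one_of_one_le₀ (by linarith)
  have hrδ : 1 - r ≤ δ := by
    have : r * (1 + δ) = 1 := inv_mul_cancel₀ hr0.ne'
    nlinarith
  have hψ1 : ‖ψ 1‖ ≤ 1 + δ := by
    calc ‖ψ 1‖ = ‖1 + (ψ 1 - 1)‖ := by rw [add_sub_cancel]
      _ ≤ ‖(1 : Mat k)‖ + ‖ψ 1 - 1‖ := norm_add_le _ _
      _ ≤ 1 + δ := by rw [hone]; gcongr
  set b : Mat k := 1 - (r : ℂ) • ψ 1 with hb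
  have hb0 : 0 ≤ b := by
    have h := complex_smul_nonneg (cp_map_nonneg ψ zero_le_one) hrpos.le
    refine sub_nonneg.mpr ((CStarAlgebra.norm_le_one_iff_of_nonneg _ h).mp ?_)
    rw [norm_smul, Complex.norm_real, Real.norm_of_nonneg hrpos.le]
    calc r * ‖ψ 1‖ ≤ r * (1 + δ) := by gcongr
      _ = 1 := inv_mul_cancel₀ hr0.ne'
  have hbn : ‖b‖ ≤ 2 * δ := by
    have e : b = (r : ℂ) • (1 - ψ 1) + ((1 - r : ℝ) : ℂ) • 1 := by
      rw [hb, Complex.ofReal_sub, Complex.ofReal_one]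
      module
    rw [e]
    refine (norm_add_le _ _).trans ?_
    rw [norm_smul, norm_smul, Complex.norm_real, Complex.norm_real, hone,
      Real.norm_of_nonneg hrpos.le, Real.norm_of_nonneg (by linarith), norm_sub_rev]
    nlinarith [norm_nonneg (ψ 1 - 1)]
  obtain ⟨χ, hχ⟩ := exists_cp_smul hτ h1 hb0
  refine ⟨cpAdd (cpSMul r hrpos.le ψ) χ, ?_, fun a => ?_, fun y => ?_⟩
  · rw [cpAdd_apply, cpSMul_apply, hχ, h1, one_smul, hb, add_sub_cancel]
  · have e : cpAdd (cpSMul r hrpos.le ψ) χ a - ψ a = -((1 - r : ℝ) : ℂ) • ψ a + τ a • b := by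
      rw [cpAdd_apply, cpSMul_apply, hχ, Complex.ofReal_sub, Complex.ofReal_one]
      module
    rw [e]
    refine (norm_add_le _ _).trans ?_
    rw [norm_smul, norm_smul, norm_neg, Complex.norm_real, Real.norm_of_nonneg (by linarith)]
    have h2 : ‖ψ a‖ ≤ 4 * ‖a‖ := (cp_norm_le ψ a).trans (by gcongr; linarith)
    have h3 := norm_apply_le_of_nonneg hτ h1 a
    calc (1 - r) * ‖ψ a‖ + ‖τ a‖ * ‖b‖ ≤ δ * (4 * ‖a‖) + 2 * ‖a‖ * (2 * δ) := by gcongr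
      _ = 8 * δ * ‖a‖ := by ring
  · have e : trComp (cpAdd (cpSMul r hrpos.le ψ) χ) =
        (r : ℂ) • trComp ψ + tr k b • τ := by
      ext a
      change tr k (cpAdd (cpSMul r hrpos.le ψ) χ a) = (r : ℂ) • tr k (ψ a) + tr k b • τ a
      rw [cpAdd_apply, cpSMul_apply, hχ, map_add, map_smul, map_smul, smul_eq_mul (τ a),
        smul_eq_mul (tr k b), mul_comm (τ a)]
    have e2 : y (trComp (cpAdd (cpSMul r hrpos.le ψ) χ)) - y (trComp ψ) =
        -((1 - r : ℝ) : ℂ) * y (trComp ψ) + tr k b * y τ := by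
      rw [e, map_add, map_smul, map_smul, smul_eq_mul, smul_eq_mul]
      push_cast
      ring
    rw [e2]
    refine (norm_add_le _ _).trans ?_
    rw [norm_mul, norm_mul, norm_neg, Complex.norm_real, Real.norm_of_nonneg (by linarith)]
    have h4 := (norm_tr_le b).trans hbn
    gcongr

end Unitalization

theorem norm_mul_sub_mul_le {R : Type*} [NormedRing R] (x x' y y' : R) :
    ‖x * y - x' * y'‖ ≤ ‖x - x'‖ * ‖y‖ + ‖x'‖ * ‖y - y'‖ := by
  have e : x * y - x' * y' = (x - x') * y + x' * (y - y') := by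
    rw [sub_mul, mul_sub]
    abel
  rw [e]
  exact (norm_add_le _ _).trans (add_le_add (norm_mul_le _ _) (norm_mul_le _ _))

theorem IsMatrixNorm.le_add_norm_sub {N : ∀ k, Mat k → ℝ} (hN : IsMatrixNorm N) {k : ℕ}
    (x y : Mat k) : N k x ≤ N k y + ‖x - y‖ := by
  calc N k x = N k (y + (x - y)) := by rw [add_sub_cancel]
    _ ≤ N k y + N k (x - y) := hN.add_le _ _ _
    _ ≤ N k y + ‖x - y‖ := by gcongr; exact hN.le_norm _ _

/-! ### Matching τ against one element of the bidual -/

section OneFunctional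

/-- A single element of the bidual is matched by almost multiplicative completely positive maps
which are almost unital. -/
theorem exists_almost_unital (hA : IsLocallyReflexive A) {N : ∀ k, Mat k → ℝ}
    (hN : IsMatrixNorm N) {τ : StrongDual ℂ A} (φ : UCPSeq A)
    (hmul : ∀ a b : A, Tendsto (fun n => N _ (φ.map n (a * b) - φ.map n a * φ.map n b)) atTop (𝓝 0))
    (hlim : φ.TendstoWeakStar τ) {ι : Type*} [Fintype ι] (c : ι → A) {M : ℝ} (hM1 : 1 ≤ M)
    (hM : ∀ i, ‖c i‖ ≤ M) (y : StrongDual ℂ (StrongDual ℂ A)) {δ : ℝ} (hδ : 0 < δ) (hδ1 : δ ≤ 1) :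
    ∃ (k : ℕ) (ψ : A →CP Mat k), 0 < k ∧ ‖ψ 1 - 1‖ < δ ∧
      (∀ i j, N k (ψ (c i * c j) - ψ (c i) * ψ (c j)) < δ) ∧ ‖y (trComp ψ) - y τ‖ < δ := by
  -- Controlled at once: the unit, the elements c i, and their products.
  let a (l : Option (ι ⊕ ι × ι)) : A := l.elim 1 (Sum.elim c fun p => c p.1 * c p.2)
  have hM0 : 0 < M := by linarith
  -- Moving the points costs at most 4Mδ₁ in a product; the bound 2 for the unital map φ doubles
  -- this to δ/2. The other δ/2 is the multiplicative defect of φ.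
  set δ₁ : ℝ := δ / (16 * M) with hδ₁
  have hδ₁0 : 0 < δ₁ := by positivity
  have hδ₁M : 16 * (M * δ₁) = δ := by
    rw [hδ₁]
    field_simp
  have hδ₁le : δ₁ ≤ M * δ₁ := le_mul_of_one_le_left hδ₁0.le hM1
  obtain ⟨b, z, hb, hz, hcl⟩ := exists_approx_points hA a y τ hδ₁0
  have hb1 : ‖b none - 1‖ < δ₁ := hb none
  have hbi (i : ι) : ‖b (some (.inl i)) - c i‖ < δ₁ := hb (some (.inl i))
  have hbij (i j : ι) : ‖b (some (.inr (i, j))) - c i * c j‖ < δ₁ := hb (some (.inr (i, j)))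
  have hbmul (i j : ι) :
      ‖b (some (.inr (i, j))) - b (some (.inl i)) * b (some (.inl j))‖ ≤ 4 * (M * δ₁) := by
    have h1 := norm_sub_le_norm_sub_add_norm_sub (b (some (.inr (i, j)))) (c i * c j)
      (b (some (.inl i)) * b (some (.inl j)))
    have h2 := norm_mul_sub_mul_le (b (some (.inl i))) (c i) (b (some (.inl j))) (c j)
    have h3 : ‖b (some (.inl j))‖ ≤ M + 1 := by
      have := norm_le_norm_add_norm_sub' (b (some (.inl j))) (c j)
      have := hbi j
      have := hM j
      linarith
    have h4 : ‖b (some (.inl i)) - c i‖ * ‖b (some (.inl j))‖ ≤ δ₁ * (M + 1) :=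
      mul_le_mul (hbi i).le h3 (norm_nonneg _) hδ₁0.le
    have h5 : ‖c i‖ * ‖b (some (.inl j)) - c j‖ ≤ M * δ₁ :=
      mul_le_mul (hM i) (hbi j).le (norm_nonneg _) hM0.le
    rw [norm_sub_rev] at h2
    have := hbij i j
    linarith
  have hev : ∀ᶠ n in atTop, (∀ p : ι × ι, N _ (φ.map n (b (some (.inl p.1)) * b (some (.inl p.2))) -
      φ.map n (b (some (.inl p.1))) * φ.map n (b (some (.inl p.2)))) < δ / 2) ∧
      ‖trComp (φ.map n) z - τ z‖ < δ / 2 := by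
    refine (eventually_all.mpr fun p => (hmul _ _).eventually_lt_const (half_pos hδ)).and ?_
    filter_upwards [(hlim z).eventually (Metric.ball_mem_nhds _ (half_pos hδ))] with n hn
    rwa [← dist_eq_norm]
  obtain ⟨n, hn1, hn2⟩ := hev.exists
  have hunital (x : A) : ‖φ.map n x‖ ≤ 2 * ‖x‖ := by
    have : Nonempty (Fin (φ.size n)) := ⟨⟨0, φ.size_pos n⟩⟩
    have h := cp_norm_le (φ.map n) x
    rwa [φ.map_one, norm_one, mul_one] at h
  -- All requirements on ψ are open conditions on its values; φ satisfies them at the perturbed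
  -- points, so some approximating ψ does at the original ones.
  let U : Set ((Option (ι ⊕ ι × ι) → Mat (φ.size n)) × Mat (φ.size n)) :=
    {p | ‖p.1 none - 1‖ < δ} ∩ ((⋂ q : ι × ι, {p | N _ (p.1 (some (.inr q)) -
      p.1 (some (.inl q.1)) * p.1 (some (.inl q.2))) < δ}) ∩ {p | ‖tr _ p.2 - y τ‖ < δ})
  have hcoord (l : Option (ι ⊕ ι × ι)) : Continuous
      fun p : (Option (ι ⊕ ι × ι) → Mat (φ.size n)) × Mat (φ.size n) => p.1 l :=
    (continuous_apply l).comp continuous_fst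
  have hU : IsOpen U := by
    refine (isOpen_lt ((hcoord none).sub continuous_const).norm continuous_const).inter
      ((isOpen_iInter_of_finite fun q => isOpen_lt ((hN.continuous _).comp
        ((hcoord _).sub ((hcoord _).mul (hcoord _)))) continuous_const).inter
        (isOpen_lt ((((continuous_tr _).comp continuous_snd).sub continuous_const).norm)
          continuous_const))
  have hmem : ((fun l => φ.map n (b l), φ.map n z) :
      (Option (ι ⊕ ι × ι) → Mat (φ.size n)) × Mat (φ.size n)) ∈ U := by
    refine ⟨?_, Set.mem_iInter.mpr fun q => ?_, ?_⟩
    · change ‖φ.map n (b none) - 1‖ < δ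
      rw [← φ.map_one n, ← map_sub]
      have := hunital (b none - 1)
      linarith
    · change N _ (φ.map n (b (some (.inr q))) -
        φ.map n (b (some (.inl q.1))) * φ.map n (b (some (.inl q.2)))) < δ
      refine (hN.le_add_norm_sub _ (φ.map n (b (some (.inl q.1)) * b (some (.inl q.2))) -
        φ.map n (b (some (.inl q.1))) * φ.map n (b (some (.inl q.2))))).trans_lt ?_
      rw [sub_sub_sub_cancel_right, ← map_sub]
      have h1 := hunital (b (some (.inr q)) - b (some (.inl q.1)) * b (some (.inl q.2)))
      have h2 := hbmul q.1 q.2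
      have h3 := hn1 q
      linarith
    · change ‖trComp (φ.map n) z - y τ‖ < δ
      have := norm_sub_le_norm_sub_add_norm_sub (trComp (φ.map n) z) (τ z) (y τ)
      linarith
  obtain ⟨_, ⟨h1, h2, h3⟩, ψ, rfl⟩ := mem_closure_iff.mp (hcl _ (φ.map n)) U hU hmem
  refine ⟨φ.size n, ψ, φ.size_pos n, h1, fun i j => Set.mem_iInter.mp h2 (i, j), ?_⟩
  have h3' : ‖tr _ (normalExtension ψ y) - y τ‖ < δ := h3
  rwa [tr_normalExtension] at h3'

end OneFunctional

/-! ### Convexity, separation and the diagonal argument -/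

/-- The weights p/(p+q) are dense in [0,1], and a convex combination depends continuously on the
weight and the two points jointly. -/
theorem convex_closure_of_natWeights {V : Type*} [NormedAddCommGroup V] [NormedSpace ℝ V]
    {S : Set V} (hS : ∀ f ∈ S, ∀ g ∈ S, ∀ p q : ℕ, 0 < p → 0 < q →
      ((p : ℝ) / (p + q)) • f + (1 - (p : ℝ) / (p + q)) • g ∈ S) : Convex ℝ (closure S) := by
  let D : Set ℝ := {t | ∃ p q : ℕ, 0 < p ∧ 0 < q ∧ t = (p : ℝ) / (p + q)}
  have hD : Set.Icc (0 : ℝ) 1 ⊆ closure D := by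
    rw [← closure_Ioo zero_ne_one]
    refine closure_minimal (((Rat.denseRange_cast (𝕜 := ℝ)).open_subset_closure_inter
      isOpen_Ioo).trans (closure_mono ?_)) isClosed_closure
    rintro _ ⟨⟨h0, h1⟩, t, rfl⟩
    have h0' : 0 < t := Rat.cast_pos.mp h0
    have h1' : t < 1 := by exact_mod_cast h1
    have hn : 0 < t.num := Rat.num_pos.mpr h0'
    have hlt : t.num < t.den := Rat.num_lt_denom_iff.mpr h1'
    refine ⟨t.num.toNat, t.den - t.num.toNat, by omega, by omega, ?_⟩
    have e : ((t.num.toNat : ℕ) : ℝ) = (t.num : ℝ) := by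
      exact_mod_cast congrArg (Int.cast : ℤ → ℝ) (Int.toNat_of_nonneg hn.le)
    rw [Nat.cast_sub (by omega), add_sub_cancel, e]
    exact Rat.cast_def t
  intro f hf g hg a b ha hb hab
  have hb' : b = 1 - a := by linarith
  subst hb'
  have hmem : ((a, f, g) : ℝ × V × V) ∈ closure (D ×ˢ S ×ˢ S) := by
    rw [closure_prod_eq, closure_prod_eq]
    exact ⟨hD ⟨ha, by linarith⟩, hf, hg⟩
  have hc : Continuous fun x : ℝ × V × V => x.1 • x.2.1 + (1 - x.1) • x.2.2 := by fun_prop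
  refine map_mem_closure (f := fun x : ℝ × V × V => x.1 • x.2.1 + (1 - x.1) • x.2.2) hc hmem ?_
  rintro ⟨_, u, v⟩ ⟨⟨p, q, hp, hq, rfl⟩, hu, hv⟩
  exact hS u hu v hv p q hp hq

variable {A : Type u} [CStarAlgebra A] [PartialOrder A] [StarOrderedRing A]

/-- The functionals `tr ∘ ψ` for unital completely positive maps `ψ` to matrix algebras which are
multiplicative up to `ε` on the family `c`. -/
def almostMulTraces (N : ∀ k, Mat k → ℝ) {ι : Type*} (c : ι → A) (ε : ℝ) : Set (StrongDual ℂ A) :=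
  {f | ∃ (k : ℕ) (ψ : A →CP Mat k), 0 < k ∧ ψ 1 = 1 ∧
    (∀ i j, N k (ψ (c i * c j) - ψ (c i) * ψ (c j)) < ε) ∧ f = trComp ψ}

theorem trComp_blockCP {κ : Type} [Fintype κ] [DecidableEq κ] {k : κ → ℕ} (hk : ∀ i, 0 < k i)
    (ψ : ∀ i, A →CP Mat (k i)) :
    trComp (blockCP ψ) = (blockSize k : ℂ)⁻¹ • ∑ i, (k i : ℂ) • trComp (ψ i) := by
  ext a
  rw [smul_apply, sum_apply]
  change tr _ (blockCP ψ a) = _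
  rw [blockCP_apply, tr_blockDiag k hk]
  rfl

theorem almostMulTraces_natWeights {N : ∀ k, Mat k → ℝ} (hN : IsMatrixNorm N) {ι : Type*}
    (c : ι → A) {ε : ℝ} (hε : 0 < ε) (f : StrongDual ℂ A) (hf : f ∈ almostMulTraces N c ε)
    (g : StrongDual ℂ A) (hg : g ∈ almostMulTraces N c ε) (p q : ℕ) (hp : 0 < p) (hq : 0 < q) :
    ((p : ℝ) / (p + q)) • f + (1 - (p : ℝ) / (p + q)) • g ∈ almostMulTraces N c ε := by
  obtain ⟨k₁, ψ₁, hk₁, h1₁, hm₁, rfl⟩ := hf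
  obtain ⟨k₂, ψ₂, hk₂, h1₂, hm₂, rfl⟩ := hg
  -- Multiplicities p k₂ and q k₁ offset the different matrix sizes: the blocks occupy total
  -- dimensions p k₁k₂ and q k₁k₂, in ratio p : q.
  let ψ : Fin (p * k₂) ⊕ Fin (q * k₁) → Σ k, A →CP Mat k :=
    Sum.elim (fun _ => ⟨k₁, ψ₁⟩) (fun _ => ⟨k₂, ψ₂⟩)
  have hk (i) : 0 < (ψ i).1 := by rcases i with i | i <;> assumption
  have : Nonempty (Fin (p * k₂) ⊕ Fin (q * k₁)) := ⟨.inl ⟨0, Nat.mul_pos hp hk₂⟩⟩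
  refine ⟨blockSize fun i => (ψ i).1, blockCP fun i => (ψ i).2, blockSize_pos _ hk, ?_,
    fun i j => ?_, ?_⟩
  · rw [blockCP_apply, ← blockDiag_one]
    congr 1
    funext i
    rcases i with i | i
    · exact h1₁
    · exact h1₂
  · rw [blockCP_apply, blockCP_apply, blockCP_apply, ← map_mul, ← map_sub]
    refine hN.blockDiag_lt _ hk _ hε fun l => ?_
    rcases l with l | l
    · exact hm₁ i j
    · exact hm₂ i j
  · rw [trComp_blockCP hk, blockSize_eq_sum]
    have hp' : (p : ℂ) ≠ 0 := Nat.cast_ne_zero.mpr hp.ne'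
    have hq' : (q : ℂ) ≠ 0 := Nat.cast_ne_zero.mpr hq.ne'
    have hpq : (p : ℂ) + q ≠ 0 := by exact_mod_cast (Nat.add_pos_left hp q).ne'
    have hk₁' : (k₁ : ℂ) ≠ 0 := Nat.cast_ne_zero.mpr hk₁.ne'
    have hk₂' : (k₂ : ℂ) ≠ 0 := Nat.cast_ne_zero.mpr hk₂.ne'
    ext a
    rw [Fintype.sum_sum_type, Fintype.sum_sum_type]
    simp only [ψ, Sum.elim_inl, Sum.elim_inr, Finset.sum_const, Finset.card_univ, Fintype.card_fin]
    simp only [add_apply, smul_apply, Complex.real_smul, smul_eq_mul, nsmul_eq_mul]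
    push_cast
    field_simp
    ring

theorem convex_closure_almostMulTraces {N : ∀ k, Mat k → ℝ} (hN : IsMatrixNorm N) {ι : Type*}
    (c : ι → A) {ε : ℝ} (hε : 0 < ε) : Convex ℝ (closure (almostMulTraces N c ε)) :=
  convex_closure_of_natWeights (almostMulTraces_natWeights hN c hε)

theorem exists_mem_almostMulTraces_near (hA : IsLocallyReflexive A) {N : ∀ k, Mat k → ℝ}
    (hN : IsMatrixNorm N) {τ : StrongDual ℂ A} (hτ : τ ∈ TracialStates A) (φ : UCPSeq A)
    (hmul : ∀ a b : A, Tendsto (fun n => N _ (φ.map n (a * b) - φ.map n a * φ.map n b)) atTop (𝓝 0))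
    (hlim : φ.TendstoWeakStar τ) {ι : Type*} [Fintype ι] (c : ι → A)
    (y : StrongDual ℂ (StrongDual ℂ A)) {ε ε' : ℝ} (hε : 0 < ε) (hε' : 0 < ε') :
    ∃ f ∈ almostMulTraces N c ε, ‖y f - y τ‖ < ε' := by
  obtain ⟨M₀, hM₀⟩ := (Set.finite_range fun i => ‖c i‖).bddAbove
  set M := max 1 M₀
  have hM1 : 1 ≤ M := le_max_left _ _
  have hM (i : ι) : ‖c i‖ ≤ M := (hM₀ ⟨i, rfl⟩).trans (le_max_right _ _)
  -- Making ψ unital changes the multiplicative defect by at most (8 + 16 + 32)δM². The value of y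
  -- moves by δ(‖y τ‖ + 1) + 2δ‖y τ‖, on top of the δ already present.
  obtain ⟨δ, hδ, hδ1, hδ2, hδ3⟩ : ∃ δ : ℝ, 0 < δ ∧ δ ≤ 1 ∧ δ * (1 + 56 * M ^ 2) ≤ ε ∧
      δ * (3 * ‖y τ‖ + 2) ≤ ε' / 2 := by
    have h1 : 0 < 1 + 56 * M ^ 2 := by positivity
    have h2 : 0 < 3 * ‖y τ‖ + 2 := by positivity
    refine ⟨min 1 (min (ε / (1 + 56 * M ^ 2)) (ε' / 2 / (3 * ‖y τ‖ + 2))), by positivity,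
      min_le_left _ _, ?_, ?_⟩
    · rw [← le_div_iff₀ h1]
      exact (min_le_right _ _).trans (min_le_left _ _)
    · rw [← le_div_iff₀ h2]
      exact (min_le_right _ _).trans (min_le_right _ _)
  obtain ⟨k, ψ, hk, h1, hm, ht⟩ := exists_almost_unital hA hN φ hmul hlim c hM1 hM y hδ hδ1
  obtain ⟨ψ', h1', hψ', ht'⟩ := exists_unital_near hτ.1 hτ.2.1 hk ψ hδ1 h1.le
  have : Nonempty (Fin k) := ⟨⟨0, hk⟩⟩
  refine ⟨trComp ψ', ⟨k, ψ', hk, h1', fun i j => ?_, rfl⟩, ?_⟩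
  · refine (hN.le_add_norm_sub _ (ψ (c i * c j) - ψ (c i) * ψ (c j))).trans_lt ?_
    have hu (a : A) : ‖ψ' a‖ ≤ 2 * ‖a‖ := by
      have h := cp_norm_le ψ' a
      rwa [h1', norm_one, mul_one] at h
    have hu' (a : A) : ‖ψ a‖ ≤ 4 * ‖a‖ := by
      refine (cp_norm_le ψ a).trans ?_
      have h := norm_le_norm_add_norm_sub' (ψ 1) 1
      rw [norm_one] at h
      have : 2 * ‖ψ 1‖ ≤ 4 := by linarith
      gcongr
    have e1 : ‖ψ' (c i * c j) - ψ (c i * c j)‖ ≤ 8 * δ * (M * M) :=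
      (hψ' _).trans (by gcongr; exact (norm_mul_le _ _).trans (mul_le_mul (hM i) (hM j)
        (norm_nonneg _) (by linarith)))
    have e2 : ‖ψ' (c i) * ψ' (c j) - ψ (c i) * ψ (c j)‖ ≤
        (8 * δ * M) * (2 * M) + (4 * M) * (8 * δ * M) := by
      refine (norm_mul_sub_mul_le _ _ _ _).trans (add_le_add ?_ ?_)
      · refine mul_le_mul ((hψ' _).trans ?_) ((hu _).trans ?_) (norm_nonneg _) (by positivity)
        · gcongr; exact hM i
        · gcongr; exact hM j
      · refine mul_le_mul ((hu' _).trans ?_) ((hψ' _).trans ?_) (norm_nonneg _) (by positivity)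
        · gcongr; exact hM i
        · gcongr; exact hM j
    have e3 : ‖ψ' (c i * c j) - ψ' (c i) * ψ' (c j) - (ψ (c i * c j) - ψ (c i) * ψ (c j))‖ ≤
        56 * δ * M ^ 2 := by
      have e : ψ' (c i * c j) - ψ' (c i) * ψ' (c j) - (ψ (c i * c j) - ψ (c i) * ψ (c j)) =
          (ψ' (c i * c j) - ψ (c i * c j)) - (ψ' (c i) * ψ' (c j) - ψ (c i) * ψ (c j)) := by abel
      rw [e]
      refine (norm_sub_le _ _).trans ((add_le_add e1 e2).trans_eq ?_)
      ring
    have := hm i j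
    linarith
  · have h2 := norm_sub_le_norm_sub_add_norm_sub (y (trComp ψ')) (y (trComp ψ)) (y τ)
    have h3 := norm_le_norm_add_norm_sub' (y (trComp ψ)) (y τ)
    have h4 : δ * ‖y (trComp ψ)‖ ≤ δ * (‖y τ‖ + 1) := by gcongr; linarith
    have h5 := ht' y
    have h6 := norm_nonneg (y τ)
    nlinarith

/-- Otherwise some y in the bidual strictly separates τ from the convex closure, while
`exists_mem_almostMulTraces_near` finds a member whose value under y is closer to y(τ) than the gap.
-/
theorem mem_closure_almostMulTraces (hA : IsLocallyReflexive A) {N : ∀ k, Mat k → ℝ}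
    (hN : IsMatrixNorm N) {τ : StrongDual ℂ A} (hτ : τ ∈ TracialStates A) (φ : UCPSeq A)
    (hmul : ∀ a b : A, Tendsto (fun n => N _ (φ.map n (a * b) - φ.map n a * φ.map n b)) atTop (𝓝 0))
    (hlim : φ.TendstoWeakStar τ) {ι : Type*} [Fintype ι] (c : ι → A) {ε : ℝ} (hε : 0 < ε) :
    τ ∈ closure (almostMulTraces N c ε) := by
  by_contra hnot
  obtain ⟨y, u, hy, hu⟩ := RCLike.geometric_hahn_banach_closed_point (𝕜 := ℂ)
    (convex_closure_almostMulTraces hN c hε) isClosed_closure hnot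
  obtain ⟨f, hf, hfy⟩ := exists_mem_almostMulTraces_near hA hN hτ φ hmul hlim c y hε
    (sub_pos.mpr hu)
  have h1 := hy f (subset_closure hf)
  have h2 := (Complex.abs_re_le_norm (y f - y τ)).trans_lt hfy
  have h3 := (abs_lt.mp h2).1
  rw [Complex.sub_re] at h3
  change (y f).re < u at h1
  change -((y τ).re - u) < _ at h3
  linarith

/-- The passage from weak-⋆ convergence to norm convergence, for either matrix norm. -/
theorem exists_ucpSeq_tendstoNorm [TopologicalSpace.SeparableSpace A] (hA : IsLocallyReflexive A)
    {N : ∀ k, Mat k → ℝ} (hN : IsMatrixNorm N) {τ : StrongDual ℂ A} (hτ : τ ∈ TracialStates A)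
    (φ : UCPSeq A)
    (hmul : ∀ a b : A, Tendsto (fun n => N _ (φ.map n (a * b) - φ.map n a * φ.map n b)) atTop (𝓝 0))
    (hlim : φ.TendstoWeakStar τ) :
    ∃ ψ : UCPSeq A, (∀ a b : A,
      Tendsto (fun n => N _ (ψ.map n (a * b) - ψ.map n a * ψ.map n b)) atTop (𝓝 0)) ∧
        ψ.TendstoNorm τ := by
  let d := TopologicalSpace.denseSeq A
  have hd : DenseRange d := TopologicalSpace.denseRange_denseSeq A
  have key (n : ℕ) : ∃ (k : ℕ) (ψ : A →CP Mat k), 0 < k ∧ ψ 1 = 1 ∧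
      (∀ i j : Fin n, N k (ψ (d i * d j) - ψ (d i) * ψ (d j)) < 1 / ((n : ℝ) + 1)) ∧
      ‖τ - trComp ψ‖ < 1 / ((n : ℝ) + 1) := by
    have hn : (0 : ℝ) < 1 / ((n : ℝ) + 1) := Nat.one_div_pos_of_nat
    obtain ⟨_, ⟨k, ψ, hk, h1, hm, rfl⟩, hdist⟩ := Metric.mem_closure_iff.mp
      (mem_closure_almostMulTraces hA hN hτ φ hmul hlim (fun i : Fin n => d i) hn) _ hn
    exact ⟨k, ψ, hk, h1, hm, by rwa [← dist_eq_norm]⟩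
  choose k ψ hk h1 hm ht using key
  have hone : Tendsto (fun n : ℕ => 1 / ((n : ℝ) + 1)) atTop (𝓝 0) :=
    tendsto_one_div_add_atTop_nhds_zero_nat
  refine ⟨⟨k, hk, ψ, h1⟩, fun a b => ?_, squeeze_zero (fun _ => norm_nonneg _) (fun n => (ht n).le)
    hone⟩
  rw [Metric.tendsto_atTop]
  intro ε hε
  have hu (n : ℕ) (x : A) : ‖ψ n x‖ ≤ 2 * ‖x‖ := by
    have : Nonempty (Fin (k n)) := ⟨⟨0, hk n⟩⟩
    have h := cp_norm_le (ψ n) x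
    rwa [h1, norm_one, mul_one] at h
  -- This bounds, uniformly in n, the change of the multiplicative defect when (a, b) is replaced by
  -- (d i, d j). It is continuous in the pair and vanishes at (a, b), so density applies.
  obtain ⟨⟨i, j⟩, hij⟩ : ∃ p : ℕ × ℕ, 2 * ‖a * b - d p.1 * d p.2‖ +
      ((2 * ‖a - d p.1‖) * (2 * ‖b‖) + (2 * ‖d p.1‖) * (2 * ‖b - d p.2‖)) < ε / 2 := by
    refine (hd.prodMap hd).exists_mem_open (s := {z : A × A | 2 * ‖a * b - z.1 * z.2‖ +
      ((2 * ‖a - z.1‖) * (2 * ‖b‖) + (2 * ‖z.1‖) * (2 * ‖b - z.2‖)) < ε / 2})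
      (isOpen_lt (by fun_prop) continuous_const) ⟨(a, b), ?_⟩
    simpa using hε
  have hsmall := hone.eventually (gt_mem_nhds (half_pos hε))
  obtain ⟨n₀, hn₀⟩ := eventually_atTop.mp
    (hsmall.and ((eventually_gt_atTop i).and (eventually_gt_atTop j)))
  refine ⟨n₀, fun n hn => ?_⟩
  obtain ⟨hnε, hni, hnj⟩ := hn₀ n hn
  rw [Real.dist_0_eq_abs, abs_of_nonneg (hN.nonneg _ _)]
  refine (hN.le_add_norm_sub _ (ψ n (d i * d j) - ψ n (d i) * ψ n (d j))).trans_lt ?_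
  have e1 := hm n ⟨i, hni⟩ ⟨j, hnj⟩
  have e2 : ‖ψ n (a * b) - ψ n a * ψ n b - (ψ n (d i * d j) - ψ n (d i) * ψ n (d j))‖ ≤
      2 * ‖a * b - d i * d j‖ +
        ((2 * ‖a - d i‖) * (2 * ‖b‖) + (2 * ‖d i‖) * (2 * ‖b - d j‖)) := by
    rw [sub_sub_sub_comm, ← map_sub]
    refine (norm_sub_le _ _).trans (add_le_add (hu n _) ((norm_mul_sub_mul_le _ _ _ _).trans ?_))
    rw [← map_sub, ← map_sub]
    exact add_le_add (mul_le_mul (hu n _) (hu n _) (norm_nonneg _) (by positivity))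
      (mul_le_mul (hu n _) (hu n _) (norm_nonneg _) (by positivity))
  change N (k n) (ψ n (d i * d j) - ψ n (d i) * ψ n (d j)) + _ < ε
  linarith

end AFDTraces

end

open AFDTraces

theorem mainTheorem5 (A : Type u) [CStarAlgebra A] [PartialOrder A] [StarOrderedRing A]
    [TopologicalSpace.SeparableSpace A] (hA : AFDTraces.IsLocallyReflexive A) :
    AFDTraces.T_wAFD A = AFDTraces.UT_wAFD A ∧ AFDTraces.T_AFD A = AFDTraces.UT_AFD A := by
  have hweak (φ : UCPSeq A) (τ : StrongDual ℂ A) (h : φ.TendstoNorm τ) : φ.TendstoWeakStar τ := by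
    intro a
    rw [tendsto_iff_norm_sub_tendsto_zero]
    refine squeeze_zero (fun _ => norm_nonneg _) (fun n => ?_)
      (by simpa using Tendsto.mul_const ‖a‖ h)
    rw [norm_sub_rev]
    exact (τ - trComp (φ.map n)).le_opNorm a
  refine ⟨Set.Subset.antisymm ?_ ?_, Set.Subset.antisymm ?_ ?_⟩
  · rintro τ ⟨hτ, φ, hmul, hlim⟩
    exact ⟨hτ, exists_ucpSeq_tendstoNorm hA isMatrixNorm_twoNorm hτ φ hmul hlim⟩
  · rintro τ ⟨hτ, φ, hmul, hlim⟩
    exact ⟨hτ, φ, hmul, hweak φ τ hlim⟩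
  · rintro τ ⟨hτ, φ, hmul, hlim⟩
    exact ⟨hτ, exists_ucpSeq_tendstoNorm hA isMatrixNorm_norm hτ φ hmul hlim⟩
  · rintro τ ⟨hτ, φ, hmul, hlim⟩
    exact ⟨hτ, φ, hmul, hweak φ τ hlim⟩
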